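/- For a finite simple graph $G$ on a vertex set $V$ with $|V|=n$, the $3$-clique tensor $\mathcal A_3(G)=(a_{ijk})$ is the $n\times n\times n$ tensor with $a_{ijk}=\tfrac12$ if $\{i,j,k\}$ is a $3$-clique (the vertex set of a triangle) of $G$, and $a_{ijk}=0$ otherwise. A complex number $\lambda$ is an eigenvalue of $\mathcal A_3(G)$ if there is a nonzero $x\in\mathbb C^V$ with $\sum_{j,k\in V}a_{ijk}x_jx_k=\lambda x_i^2$ for every $i\in V$, and the $3$-clique spectral radius $\mu_3(G)$ is the maximum of $|\lambda|$ over all eigenvalues $\lambda$ of $\mathcal A_3(G)$. A graph is $2K_3$-free if it does not contain two vertex-disjoint triangles. Let $G\cup H$ denote the disjoint union, $G\vee H$ the join (the disjoint union together with all edges between $G$ and $H$), $mK_1$ the graph of $m$ isolated vertices, and $T_2(m)$ the complete bipartite graph on $m$ vertices whose part sizes differ by at most one. Let $G_0$ be the graph obtained from $K_5\cup K_1$ by adding one edge between the isolated vertex and a vertex of $K_5$. **Theorem.** Let $G$ be a $2K_3$-free graph on $n\ge 3$ vertices. Then \[ \mu_3(G)\le \begin{cases} \mu_3(K_n), & 3\le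 n\le 5,\\ \mu_3(K_5\cup K_1), & n=6,\\ \mu_3(K_3\vee (n-3)K_1), & 7\le n\le 13,\\ \mu_3(K_1\vee T_2(n-1)), & n\ge 14. \end{cases} \] Moreover: (i) for $3\le n\le 5$, equality holds if and only if $G\cong K_n$; (ii) for $n=6$, equality holds if and only if $G\cong K_5\cup K_1$ or $G\cong G_0$; (iii) for $7\le n\le 13$, equality holds if and only if $G\cong K_3\vee (n-3)K_1$; (iv) for $n\ge 14$, equality holds if and only if $G\cong K_1\vee T_2(n-1)$. All the graphs named in (i)–(iv) are themselves $2K_3$-free for the corresponding $n$, so these bounds are the maximum values of $\mu_3$ over all $2K_3$-free graphs on $n$ vertices. -/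

import Mathlib

universe u

namespace CliqueSpectral

open scoped Classical in
/-- The `r`-clique tensor of a graph `G` (order `r`, dimension `|V|`).  An order `r` tensor is
written with its first index `i` separated from the remaining `r - 1` indices `f`: the entry at
`(i, f 0, …, f (r - 2))` is `1 / (r - 1)!` if `{i, f 0, …, f (r - 2)}` is an `r`-clique of `G`,
and `0` otherwise. -/
noncomputable def cliqueTensor {V : Type*} (G : SimpleGraph V) (r : ℕ) :
    V → (Fin (r - 1) → V) → ℂ :=
  fun i f => if insert i (Finset.univ.image f) ∈ G.cliqueSet r then
    1 / (Nat.factorial (r - 1) : ℂ) else 0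

/-- The vector `A x^(r-1)`, whose `i`-th component is the sum over `i₂, …, i_r` of
`a_{i i₂ … i_r} x_{i₂} ⋯ x_{i_r}`. -/
noncomputable def tensorApply {V : Type*} [Fintype V] {r : ℕ} (A : V → (Fin (r - 1) → V) → ℂ)
    (x : V → ℂ) : V → ℂ :=
  open scoped Classical in fun i => ∑ f : Fin (r - 1) → V, A i f * ∏ j, x (f j)

/-- The set of eigenvalues of an order `r` tensor: all complex `z` such that
`A x^(r-1) = z x^[r-1]` for some nonzero complex vector `x`. -/
def tensorEigenvalues {V : Type*} [Fintype V] {r : ℕ} (A : V → (Fin (r - 1) → V) → ℂ) : Set ℂ :=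
  {z | ∃ x : V → ℂ, x ≠ 0 ∧ ∀ i, tensorApply A x i = z * x i ^ (r - 1)}

/-- The spectral radius of a tensor: the largest modulus of an eigenvalue. -/
noncomputable def tensorSpectralRadius {V : Type*} [Fintype V] {r : ℕ}
    (A : V → (Fin (r - 1) → V) → ℂ) : ℝ :=
  sSup ((fun z : ℂ => ‖z‖) '' tensorEigenvalues A)

/-- The `r`-clique spectral radius `μ_r(G)`. -/
noncomputable def cliqueSpectralRadius {V : Type*} [Fintype V] (r : ℕ) (G : SimpleGraph V) : ℝ :=
  tensorSpectralRadius (cliqueTensor G r)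

/-- The join `G ∨ H`: the disjoint union of `G` and `H` together with all edges between them. -/
def join {V W : Type*} (G : SimpleGraph V) (H : SimpleGraph W) : SimpleGraph (V ⊕ W) :=
  (G ⊕g H) ⊔ completeBipartiteGraph V W

/-- The complete graph `K_n`. -/
abbrev K (n : ℕ) : SimpleGraph (Fin n) := ⊤

/-- The graph `n K_1`, i.e. `n` isolated vertices. -/
abbrev isolated (n : ℕ) : SimpleGraph (Fin n) := ⊥

/-- The graph `2 K_3`: two vertex-disjoint triangles. -/
abbrev twoK3 : SimpleGraph (Fin 3 ⊕ Fin 3) := K 3 ⊕g K 3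

/-- The graph `G_0`: the disjoint union of `K_5` and an isolated vertex, plus one edge joining the
isolated vertex to a vertex of `K_5`. -/
def G₀ : SimpleGraph (Fin 5 ⊕ Fin 1) := (K 5 ⊕g K 1) ⊔ SimpleGraph.edge (Sum.inl 0) (Sum.inr 0)

theorem tensorApply_smul {V : Type*} [Fintype V] {r : ℕ} (A : V → (Fin (r - 1) → V) → ℂ)
    (c : ℂ) (x : V → ℂ) (i : V) :
    tensorApply A (c • x) i = c ^ (r - 1) * tensorApply A x i := by
  unfold tensorApply
  rw [Finset.mul_sum]
  refine Finset.sum_congr rfl fun f _ => ?_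
  simp [Finset.prod_mul_distrib]
  ring

theorem isCompact_tensorEigenvalues {V : Type*} [Fintype V] {r : ℕ}
    (A : V → (Fin (r - 1) → V) → ℂ) : IsCompact (tensorEigenvalues A) := by
  classical
  set C : ℝ := ∑ i, ∑ f, ‖A i f‖
  have hcont : ∀ i, Continuous fun x : V → ℂ => tensorApply A x i := by
    intro i
    unfold tensorApply
    fun_prop
  have hbound : ∀ z : ℂ, ∀ x : V → ℂ, ‖x‖ = 1 →
      (∀ i, tensorApply A x i = z * x i ^ (r - 1)) → ‖z‖ ≤ C := by
    intro z x hx h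
    have hle : ∀ i, ‖x i‖ ≤ 1 := fun i => hx ▸ norm_le_pi_norm x i
    obtain ⟨i, hi⟩ : ∃ i, ‖x i‖ = 1 := by
      by_contra! hne
      have : ‖x‖ < 1 := (pi_norm_lt_iff one_pos).2 fun i => lt_of_le_of_ne (hle i) (hne i)
      linarith
    have h1 : ‖z‖ = ‖tensorApply A x i‖ := by rw [h i, norm_mul, norm_pow, hi]; simp
    rw [h1]
    calc ‖tensorApply A x i‖ ≤ ∑ f, ‖A i f‖ := by
          unfold tensorApply
          refine (norm_sum_le _ _).trans ?_
          refine le_of_eq_of_le (Finset.sum_congr (by congr!) fun _ _ => rfl)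
            (Finset.sum_le_sum fun f _ => ?_)
          rw [norm_mul, norm_prod]
          exact mul_le_of_le_one_right (norm_nonneg _)
            (Finset.prod_le_one (fun _ _ => norm_nonneg _) fun j _ => hle _)
      _ ≤ C := Finset.single_le_sum (f := fun i => ∑ f, ‖A i f‖)
          (fun _ _ => Finset.sum_nonneg fun _ _ => norm_nonneg _) (Finset.mem_univ i)
  have hK : IsCompact ((Metric.closedBall (0 : ℂ) C ×ˢ Metric.sphere (0 : V → ℂ) 1) ∩
      {p : ℂ × (V → ℂ) | ∀ i, tensorApply A p.2 i = p.1 * p.2 i ^ (r - 1)}) := by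
    refine ((isCompact_closedBall _ _).prod (isCompact_sphere _ _)).inter_right ?_
    rw [Set.ofPred_forall]
    exact isClosed_iInter fun i => isClosed_eq ((hcont i).comp continuous_snd) (by fun_prop)
  convert hK.image continuous_fst
  ext z
  constructor
  · rintro ⟨x, hx0, hx⟩
    have hn : ‖x‖ ≠ 0 := norm_ne_zero_iff.2 hx0
    have hn1 : ‖((‖x‖⁻¹ : ℝ) : ℂ) • x‖ = 1 := by
      rw [norm_smul]; simp [hn]
    have he : ∀ i, tensorApply A (((‖x‖⁻¹ : ℝ) : ℂ) • x) i =
        z * (((‖x‖⁻¹ : ℝ) : ℂ) • x) i ^ (r - 1) := by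
      intro i
      rw [tensorApply_smul, hx i, Pi.smul_apply, smul_eq_mul, mul_pow]
      ring
    exact ⟨(z, _), ⟨⟨by simpa using hbound z _ hn1 he, by simpa using hn1⟩, he⟩, rfl⟩
  · rintro ⟨⟨z', x⟩, ⟨⟨-, hx⟩, he⟩, rfl⟩
    refine ⟨x, ?_, he⟩
    rintro rfl
    simp at hx

/-- The supremum that defines `μ_r(G)` is a maximum (for `r ≥ 3`, `0` is always an eigenvalue). -/
theorem isGreatest_cliqueSpectralRadius {V : Type*} [Fintype V] [Nonempty V] (r : ℕ) (hr : 3 ≤ r)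
    (G : SimpleGraph V) :
    IsGreatest ((fun z : ℂ => ‖z‖) '' tensorEigenvalues (cliqueTensor G r))
      (cliqueSpectralRadius r G) := by
  classical
  refine ((isCompact_tensorEigenvalues _).image continuous_norm).isGreatest_sSup
    (Set.Nonempty.image _ ⟨0, ?_⟩)
  let v : V := Classical.arbitrary V
  refine ⟨Pi.single v 1, by simp, fun i => ?_⟩
  rw [zero_mul]
  unfold tensorApply
  refine Finset.sum_eq_zero fun f _ => ?_
  by_cases hf : ∀ j, f j = v
  · have : cliqueTensor G r i f = 0 := by
      unfold cliqueTensor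
      rw [if_neg]
      intro h
      have hc := (SimpleGraph.mem_cliqueSet_iff.1 h).card_eq
      have hs : insert i (Finset.univ.image f) ⊆ {i, v} := by
        intro a ha
        simp only [Finset.mem_insert, Finset.mem_image, Finset.mem_univ, true_and] at ha
        rcases ha with rfl | ⟨j, rfl⟩
        · simp
        · simp [hf j]
      have h2 : (insert i (Finset.univ.image f)).card ≤ 2 :=
        (Finset.card_le_card hs).trans Finset.card_le_two
      have h3 : (insert i (Finset.univ.image f)).card = r := by convert hc
      omega
    rw [this, zero_mul]
  · push Not at hf
    obtain ⟨j, hj⟩ := hf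
    rw [Finset.prod_eq_zero (Finset.mem_univ j) (by simp [hj]), mul_zero]

end CliqueSpectral

namespace CliqueSpectral

/-! For upper bounds, take moduli `z` of an eigenvector for an eigenvalue of largest modulus: the
triangle inequality gives `2 * μ₃ * ∑ z ^ 3 ≤ triangleForm G z`, so a bound on the cubic form over
nonnegative vectors bounds the radius. For lower bounds, the model graphs have explicit nonnegative
eigenvectors.

Being `2K₃`-free means that triangles pairwise intersect, and `TrianglesIntersect.cover_trichotomy`
leaves three structures. One vertex `v` meets all triangles: the link of `v` is triangle-free, and a
weighted Mantel argument (`exists_bipartition_triangleForm_le`) replaces it by a complete bipartite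
graph with parts `S`, `T`. AM-GM then gives `μ₃ ≤ (|S| |T|) ^ (2/3)`, which is largest for balanced
parts. Two vertices `a`, `b` are needed and suffice: each remaining link is dominated by a star,
with the heaviest vertex `c` outside `a`, `b` as common centre (`exists_triangleForm_le_core`). The
result is the form of `K₃ ∨ mK₁`, with radius `1 + 2mr`, where `r ^ 2 + 2mr ^ 3 = 3`. No two
vertices suffice: the graph contains a `K₅` holding every triangle, and `μ₃ = 6`.

The theorem is the comparison of the three values. At `n = 6` the value 6 is largest; from `n = 7`
on `1 + 2mr` with `m = n - 3` exceeds 6, and the bipartite value overtakes it between `n = 13` and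
`n = 14`. For `n ≤ 5`, AM-GM over all ordered triples suffices. In the bipartite, core and complete
cases, equality in AM-GM makes `z` positive with known ratios; equality in the combinatorial step
then forces every edge of the model, and in the first two the triangle conditions exclude further
edges. At `n = 6`, the vertex outside the `K₅` has at most one neighbour, hence two extremal graphs.
-/

open scoped Classical in
/-- The indicator of the ordered triples that span a triangle. -/
noncomputable def triangleIndicator {V : Type*} (G : SimpleGraph V) (i j k : V) : ℝ :=
  if G.Adj i j ∧ G.Adj i k ∧ G.Adj j k then 1 else 0

/-- Any two triangles of the graph have a common vertex. -/
def TrianglesIntersect {V : Type*} (G : SimpleGraph V) : Prop :=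
  ∀ i j k i' j' k', G.Adj i j ∧ G.Adj i k ∧ G.Adj j k → G.Adj i' j' ∧ G.Adj i' k' ∧ G.Adj j' k' →
    i' = i ∨ i' = j ∨ i' = k ∨ j' = i ∨ j' = j ∨ j' = k ∨ k' = i ∨ k' = j ∨ k' = k

/-! ### Symmetry and values of the triangle indicator. -/

section Indicator

variable {V : Type*} (G : SimpleGraph V)

theorem triangleIndicator_nonneg (i j k : V) : 0 ≤ triangleIndicator G i j k := by
  unfold triangleIndicator; split_ifs <;> norm_num

theorem triangleIndicator_le_one (i j k : V) : triangleIndicator G i j k ≤ 1 := by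
  unfold triangleIndicator; split_ifs <;> norm_num

theorem triangleIndicator_swap_left (i j k : V) :
    triangleIndicator G i j k = triangleIndicator G j i k := by
  classical exact if_congr (by rw [G.adj_comm j i]; tauto) rfl rfl

theorem triangleIndicator_swap_right (i j k : V) :
    triangleIndicator G i j k = triangleIndicator G i k j := by
  classical exact if_congr (by rw [G.adj_comm k j]; tauto) rfl rfl

theorem triangleIndicator_of_triangle {i j k : V} (h : G.Adj i j ∧ G.Adj i k ∧ G.Adj j k) :
    triangleIndicator G i j k = 1 := if_pos h

theorem triangleIndicator_of_not {i j k : V} (h : ¬(G.Adj i j ∧ G.Adj i k ∧ G.Adj j k)) :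
    triangleIndicator G i j k = 0 := if_neg h

theorem triangle_of_triangleIndicator_ne_zero {i j k : V} (h : triangleIndicator G i j k ≠ 0) :
    G.Adj i j ∧ G.Adj i k ∧ G.Adj j k := by
  by_contra h'
  exact h (triangleIndicator_of_not G h')

end Indicator

/-! ### From tensor eigenvalues to a real cubic form. -/

theorem tensorApply_cliqueTensor_three {V : Type*} [Fintype V] (G : SimpleGraph V) (x : V → ℂ)
    (i : V) : tensorApply (cliqueTensor G 3) x i =
      ∑ j, ∑ k, (triangleIndicator G i j k : ℂ) * (x j * x k) / 2 := by
  classical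
  unfold tensorApply
  rw [← Fintype.sum_prod_type' (f := fun j k => (triangleIndicator G i j k : ℂ) * (x j * x k) / 2)]
  refine Fintype.sum_equiv (finTwoArrowEquiv V) _ _ fun f => ?_
  -- Adjacency already forces the three indices to be distinct, so index pairs with repetitions need
  -- no separate treatment.
  have h : (insert i (Finset.univ.image f) ∈ G.cliqueSet 3) ↔
      G.Adj i (f 0) ∧ G.Adj i (f 1) ∧ G.Adj (f 0) (f 1) := by
    rw [SimpleGraph.mem_cliqueSet_iff, ← SimpleGraph.is3Clique_triple_iff]
    have : insert i (Finset.univ.image f) = {i, f 0, f 1} := by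
      ext a
      simp only [Finset.mem_insert, Finset.mem_image, Finset.mem_univ, true_and,
        Finset.mem_singleton]
      constructor
      · rintro (rfl | ⟨j, rfl⟩)
        · simp
        · change Fin 2 at j
          fin_cases j <;> simp
      · rintro (rfl | rfl | rfl)
        · simp
        · exact Or.inr ⟨(0 : Fin 2), rfl⟩
        · exact Or.inr ⟨(1 : Fin 2), rfl⟩
    constructor <;> intro h'
    · rw [← this]; convert h'
    · convert h'
  have hp : ∏ j, x (f j) = x (f 0) * x (f 1) := Fin.prod_univ_two (fun j : Fin 2 => x (f j))
  rw [hp]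
  have hc : cliqueTensor G 3 i f =
      if G.Adj i (f 0) ∧ G.Adj i (f 1) ∧ G.Adj (f 0) (f 1) then (1 / 2 : ℂ) else 0 := by
    have h2 : (1 / (Nat.factorial (3 - 1) : ℂ)) = 1 / 2 := by norm_num [Nat.factorial]
    rw [← h2]
    refine if_congr ?_ rfl rfl
    exact h
  rw [hc]
  have he : finTwoArrowEquiv V f = (f 0, f 1) := rfl
  rw [he]
  unfold triangleIndicator
  split_ifs <;> push_cast <;> ring

/-- The cubic form `∑ x_i x_j x_k` over the ordered triangles of a graph. -/
noncomputable def triangleForm {V : Type*} [Fintype V] (G : SimpleGraph V) (x : V → ℝ) : ℝ :=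
  ∑ i, ∑ j, ∑ k, triangleIndicator G i j k * (x i * x j * x k)

/-- A nonzero real vector satisfying the eigenvalue equations gives a lower bound for `μ₃`. -/
theorem le_cliqueSpectralRadius_of_eigenvector {V : Type*} [Fintype V] (G : SimpleGraph V)
    {c : ℝ} (y : V → ℝ) (hy : y ≠ 0)
    (h : ∀ i, ∑ j, ∑ k, triangleIndicator G i j k * (y j * y k) = 2 * c * y i ^ 2) :
    c ≤ cliqueSpectralRadius 3 G := by
  have hne : Nonempty V := by
    by_contra hV
    rw [not_nonempty_iff] at hV
    exact hy (Subsingleton.elim _ _)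
  have hmem : (c : ℂ) ∈ tensorEigenvalues (cliqueTensor G 3) := by
    refine ⟨fun i => (y i : ℂ), ?_, fun i => ?_⟩
    · intro h0
      apply hy
      funext i
      have := congrFun h0 i
      simpa using this
    · rw [tensorApply_cliqueTensor_three]
      have h2 := congrArg (fun t : ℝ => (t : ℂ)) (h i)
      push_cast at h2
      simp only [← Finset.sum_div]
      rw [h2]
      ring
  have h3 := (isGreatest_cliqueSpectralRadius 3 le_rfl G).2 ⟨_, hmem, rfl⟩
  simp only [Complex.norm_real] at h3
  exact (le_abs_self c).trans h3

/-- The spectral radius is attained by a nonnegative test vector for the triangle form. -/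
theorem exists_cliqueSpectralRadius_mul_le_triangleForm {V : Type*} [Fintype V] [Nonempty V]
    (G : SimpleGraph V) : ∃ z : V → ℝ, (∀ i, 0 ≤ z i) ∧ z ≠ 0 ∧
      2 * cliqueSpectralRadius 3 G * ∑ i, z i ^ 3 ≤ triangleForm G z := by
  obtain ⟨⟨l, ⟨x, hx0, hx⟩, hl⟩, -⟩ := isGreatest_cliqueSpectralRadius 3 le_rfl G
  replace hl : ‖l‖ = cliqueSpectralRadius 3 G := hl
  refine ⟨fun i => ‖x i‖, fun i => norm_nonneg _, ?_, ?_⟩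
  · intro h
    apply hx0
    funext i
    simpa using congrFun h i
  · unfold triangleForm
    rw [Finset.mul_sum]
    refine Finset.sum_le_sum fun i _ => ?_
    beta_reduce
    have h1 := hx i
    rw [tensorApply_cliqueTensor_three] at h1
    -- Triangle inequality in the `i`-th eigenvalue equation; multiplied by `‖x i‖` and summed over
    -- `i`, it becomes the cubic inequality.
    have h2 : ‖l * x i ^ (3 - 1)‖ ≤ ∑ j, ∑ k, triangleIndicator G i j k * (‖x j‖ * ‖x k‖) / 2 := by
      rw [← h1]
      refine (norm_sum_le _ _).trans (Finset.sum_le_sum fun j _ => ?_)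
      refine (norm_sum_le _ _).trans (Finset.sum_le_sum fun k _ => ?_)
      rw [norm_div, norm_mul, norm_mul, Complex.norm_real,
        Real.norm_of_nonneg (triangleIndicator_nonneg G i j k)]
      simp
    rw [norm_mul, norm_pow, hl] at h2
    simp only [← Finset.sum_div] at h2
    have h3 : ∑ j, ∑ k, triangleIndicator G i j k * (‖x i‖ * ‖x j‖ * ‖x k‖) =
        ‖x i‖ * ∑ j, ∑ k, triangleIndicator G i j k * (‖x j‖ * ‖x k‖) := by
      simp only [Finset.mul_sum]
      refine Finset.sum_congr rfl fun j _ => Finset.sum_congr rfl fun k _ => by ring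
    rw [h3]
    have h4 := mul_le_mul_of_nonneg_left h2 (norm_nonneg (x i))
    norm_num at h4
    nlinarith [h4]

theorem tensorEigenvalues_three_subset {V W : Type*} [Fintype V] [Fintype W]
    {G : SimpleGraph V} {H : SimpleGraph W} (e : G ≃g H) :
    tensorEigenvalues (cliqueTensor G 3) ⊆ tensorEigenvalues (cliqueTensor H 3) := by
  rintro z ⟨x, hx0, hx⟩
  refine ⟨fun w => x (e.symm w), ?_, fun w => ?_⟩
  · intro h
    apply hx0
    funext v
    simpa using congrFun h (e v)
  · rw [tensorApply_cliqueTensor_three, ← hx, tensorApply_cliqueTensor_three]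
    refine Fintype.sum_equiv e.symm.toEquiv _ _ fun j => ?_
    refine Fintype.sum_equiv e.symm.toEquiv _ _ fun k => ?_
    have : triangleIndicator G (e.symm w) (e.symm j) (e.symm k) = triangleIndicator H w j k :=
      by
        classical
        exact if_congr
          (by rw [e.symm.map_adj_iff, e.symm.map_adj_iff, e.symm.map_adj_iff]) rfl rfl
    rw [← this]
    rfl

theorem cliqueSpectralRadius_three_congr {V W : Type*} [Fintype V] [Fintype W]
    {G : SimpleGraph V} {H : SimpleGraph W} (e : G ≃g H) :
    cliqueSpectralRadius 3 G = cliqueSpectralRadius 3 H := by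
  unfold cliqueSpectralRadius tensorSpectralRadius
  rw [(tensorEigenvalues_three_subset e).antisymm (tensorEigenvalues_three_subset e.symm)]

/-! ### Symmetric sums and AM-GM for three numbers. -/

/-- Splitting a symmetric double sum at one index. -/
theorem sum_sum_insert {V : Type*} [DecidableEq V] (g : V → V → ℝ) (hs : ∀ j k, g j k = g k j)
    (h0 : ∀ j, g j j = 0) {v : V} {s : Finset V} (hv : v ∉ s) :
    ∑ j ∈ insert v s, ∑ k ∈ insert v s, g j k =
      2 * ∑ k ∈ s, g v k + ∑ j ∈ s, ∑ k ∈ s, g j k := by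
  simp only [Finset.sum_insert hv, Finset.sum_add_distrib, h0]
  have : ∑ j ∈ s, g j v = ∑ j ∈ s, g v j := Finset.sum_congr rfl fun j _ => hs j v
  rw [this]
  ring

/-- Splitting a symmetric triple sum at one index. -/
theorem sum_sum_sum_insert {V : Type*} [DecidableEq V] (f : V → V → V → ℝ)
    (hl : ∀ i j k, f i j k = f j i k) (hr : ∀ i j k, f i j k = f i k j)
    (h0 : ∀ i j, f i i j = 0) {v : V} {s : Finset V} (hv : v ∉ s) :
    ∑ i ∈ insert v s, ∑ j ∈ insert v s, ∑ k ∈ insert v s, f i j k =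
      3 * ∑ j ∈ s, ∑ k ∈ s, f v j k + ∑ i ∈ s, ∑ j ∈ s, ∑ k ∈ s, f i j k := by
  have h1 : ∀ i j, f i j i = 0 := fun i j => by rw [hr, h0]
  have h2 : ∀ i j, f i j j = 0 := fun i j => by rw [hl, h1]
  simp only [Finset.sum_insert hv, Finset.sum_add_distrib, h0, h1, h2, Finset.sum_const_zero]
  have e1 : ∑ i ∈ s, ∑ k ∈ s, f i v k = ∑ i ∈ s, ∑ k ∈ s, f v i k :=
    Finset.sum_congr rfl fun i _ => Finset.sum_congr rfl fun k _ => hl i v k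
  have e2 : ∑ i ∈ s, ∑ k ∈ s, f i k v = ∑ i ∈ s, ∑ k ∈ s, f v i k :=
    Finset.sum_congr rfl fun i _ => Finset.sum_congr rfl fun k _ => by rw [hr i k v, hl i v k]
  rw [e1, e2]
  ring

/-- The difference of the two sides is half of `u + v + w` times the sum of the squared differences;
the same factorization settles equality. -/
theorem three_mul_le_add_cubes {u v w : ℝ} (hu : 0 ≤ u) (hv : 0 ≤ v) (hw : 0 ≤ w) :
    3 * (u * v * w) ≤ u ^ 3 + v ^ 3 + w ^ 3 := by
  nlinarith [mul_nonneg (add_nonneg (add_nonneg hu hv) hw)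
    (add_nonneg (add_nonneg (sq_nonneg (u - v)) (sq_nonneg (v - w))) (sq_nonneg (u - w)))]

theorem eq_of_three_mul_eq_add_cubes {u v w : ℝ} (hu : 0 ≤ u) (hv : 0 ≤ v) (hw : 0 ≤ w)
    (h : 3 * (u * v * w) = u ^ 3 + v ^ 3 + w ^ 3) : u = v ∧ v = w := by
  have h1 : (u + v + w) * ((u - v) ^ 2 + (v - w) ^ 2 + (u - w) ^ 2) = 0 := by
    linear_combination -2 * h
  rcases mul_eq_zero.1 h1 with h2 | h2
  · constructor <;> linarith
  · have h3 : u - v = 0 := by nlinarith [sq_nonneg (u - v), sq_nonneg (v - w), sq_nonneg (u - w)]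
    have h4 : v - w = 0 := by nlinarith [sq_nonneg (u - v), sq_nonneg (v - w), sq_nonneg (u - w)]
    constructor <;> linarith

/-! ### All triangles through one vertex: a weighted Mantel theorem. -/

section Star

variable {V : Type*} [Fintype V]

theorem triangleForm_eq_insert [DecidableEq V] (G : SimpleGraph V) (x : V → ℝ) (v : V) :
    triangleForm G x =
      3 * ∑ j ∈ Finset.univ.erase v, ∑ k ∈ Finset.univ.erase v,
        triangleIndicator G v j k * (x v * x j * x k) +
      ∑ i ∈ Finset.univ.erase v, ∑ j ∈ Finset.univ.erase v, ∑ k ∈ Finset.univ.erase v,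
        triangleIndicator G i j k * (x i * x j * x k) := by
  have h := sum_sum_sum_insert (fun i j k => triangleIndicator G i j k * (x i * x j * x k))
    (fun i j k => by rw [triangleIndicator_swap_left]; ring)
    (fun i j k => by rw [triangleIndicator_swap_right]; ring)
    (fun i j => by rw [triangleIndicator_of_not] <;> simp) (Finset.notMem_erase v Finset.univ)
  rw [Finset.insert_erase (Finset.mem_univ v)] at h
  exact h

/-- If all triangles share the vertex `v`, the triangle form is dominated by the one of the join of
`v` with a complete bipartite graph on the other vertices. -/
theorem exists_bipartition_triangleForm_le [DecidableEq V] (G : SimpleGraph V) (v : V)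
    (hv : ∀ i j k, G.Adj i j ∧ G.Adj i k ∧ G.Adj j k → v = i ∨ v = j ∨ v = k) (x : V → ℝ)
    (hx : ∀ i, 0 ≤ x i) :
    ∃ S T : Finset V, Disjoint S T ∧ S ∪ T = Finset.univ.erase v ∧
      triangleForm G x ≤ 6 * x v * ((∑ i ∈ S, x i) * ∑ j ∈ T, x j) ∧
      ((∀ i, 0 < x i) → 6 * x v * ((∑ i ∈ S, x i) * ∑ j ∈ T, x j) ≤ triangleForm G x →
        ∀ i ∈ S, ∀ j ∈ T, G.Adj v i ∧ G.Adj v j ∧ G.Adj i j) := by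
  set s := Finset.univ.erase v with hs
  have hzero : ∀ i ∈ s, ∀ j ∈ s, ∀ k ∈ s, triangleIndicator G i j k = 0 := by
    intro i hi j hj k hk
    refine triangleIndicator_of_not G fun h => ?_
    have := hv i j k h
    simp only [hs, Finset.mem_erase] at hi hj hk
    tauto
  have hQ : triangleForm G x =
      3 * (x v * ∑ j ∈ s, ∑ k ∈ s, triangleIndicator G v j k * (x j * x k)) := by
    rw [triangleForm_eq_insert G x v]
    have h2 : ∑ i ∈ s, ∑ j ∈ s, ∑ k ∈ s, triangleIndicator G i j k * (x i * x j * x k) = 0 :=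
      Finset.sum_eq_zero fun i hi => Finset.sum_eq_zero fun j hj => Finset.sum_eq_zero fun k hk => by
        rw [hzero i hi j hj k hk, zero_mul]
    rw [← hs, h2, add_zero, Finset.mul_sum (a := x v)]
    congr 1
    refine Finset.sum_congr rfl fun j _ => ?_
    rw [Finset.mul_sum]
    exact Finset.sum_congr rfl fun k _ => by ring
  rcases s.eq_empty_or_nonempty with he | hne
  · exact ⟨∅, ∅, by simp, by simp [he], by rw [hQ, he]; simp, by simp⟩
  -- `u` has the largest weighted degree in the link of `v`. Its neighbourhood there becomes `S`,
  -- and everything else, including `u`, becomes `T`.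
  obtain ⟨u, hu, hmax⟩ := s.exists_max_image
    (fun j => ∑ k ∈ s, triangleIndicator G v j k * x k) hne
  set S := s.filter fun k => triangleIndicator G v u k ≠ 0 with hS
  set T := s.filter fun k => ¬(triangleIndicator G v u k ≠ 0) with hT
  have hST : Disjoint S T := Finset.disjoint_filter_filter_not s s _
  have hU : S ∪ T = s := Finset.filter_union_filter_not_eq _ s
  have hSs : S ⊆ s := Finset.filter_subset _ _
  have hTs : T ⊆ s := Finset.filter_subset _ _
  have hD : ∑ k ∈ s, triangleIndicator G v u k * x k = ∑ k ∈ S, x k := by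
    rw [hS, Finset.sum_filter]
    refine Finset.sum_congr rfl fun k _ => ?_
    split_ifs with h
    · rw [triangleIndicator_of_triangle G (triangle_of_triangleIndicator_ne_zero G h), one_mul]
    · rw [not_not.1 h, zero_mul]
  -- A link edge inside `S` would form with `u` a triangle avoiding `v`.
  have hSS : ∀ j ∈ S, ∀ k ∈ S, triangleIndicator G v j k = 0 := by
    intro j hj k hk
    by_contra h
    have hj' := triangle_of_triangleIndicator_ne_zero G (Finset.mem_filter.1 hj).2
    have hk' := triangle_of_triangleIndicator_ne_zero G (Finset.mem_filter.1 hk).2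
    have h' := triangle_of_triangleIndicator_ne_zero G h
    have h0 := hzero u hu j (hSs hj) k (hSs hk)
    rw [triangleIndicator_of_triangle G ⟨hj'.2.2, hk'.2.2, h'.2.2⟩] at h0
    exact one_ne_zero h0
  have hsplit : ∀ f : V → ℝ, ∑ j ∈ s, f j = ∑ j ∈ S, f j + ∑ j ∈ T, f j := fun f => by
    rw [← hU, Finset.sum_union hST]
  -- Every link edge meets `T`, so summing weighted degrees over `T` counts all edges, those inside
  -- `T` twice. Each such degree is at most that of `u`, which is the weight of `S`.
  have hsum : ∑ j ∈ s, ∑ k ∈ s, triangleIndicator G v j k * (x j * x k) =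
      2 * (∑ j ∈ T, x j * ∑ k ∈ s, triangleIndicator G v j k * x k) -
        ∑ j ∈ T, ∑ k ∈ T, triangleIndicator G v j k * (x j * x k) := by
    have e1 : ∑ j ∈ T, x j * ∑ k ∈ s, triangleIndicator G v j k * x k =
        ∑ j ∈ T, ∑ k ∈ S, triangleIndicator G v j k * (x j * x k) +
          ∑ j ∈ T, ∑ k ∈ T, triangleIndicator G v j k * (x j * x k) := by
      rw [← Finset.sum_add_distrib]
      refine Finset.sum_congr rfl fun j _ => ?_
      rw [← hsplit, Finset.mul_sum]
      exact Finset.sum_congr rfl fun k _ => by ring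
    have e2 : ∑ j ∈ S, ∑ k ∈ S, triangleIndicator G v j k * (x j * x k) = 0 :=
      Finset.sum_eq_zero fun j hj => Finset.sum_eq_zero fun k hk => by rw [hSS j hj k hk, zero_mul]
    have e3 : ∑ j ∈ S, ∑ k ∈ T, triangleIndicator G v j k * (x j * x k) =
        ∑ j ∈ T, ∑ k ∈ S, triangleIndicator G v j k * (x j * x k) := by
      rw [Finset.sum_comm]
      refine Finset.sum_congr rfl fun j _ => Finset.sum_congr rfl fun k _ => ?_
      rw [triangleIndicator_swap_right, mul_comm (x k)]
    rw [hsplit, e1]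
    simp only [hsplit, Finset.sum_add_distrib]
    rw [e2, e3]
    ring
  have hTT : 0 ≤ ∑ j ∈ T, ∑ k ∈ T, triangleIndicator G v j k * (x j * x k) :=
    Finset.sum_nonneg fun j _ => Finset.sum_nonneg fun k _ =>
      mul_nonneg (triangleIndicator_nonneg G _ _ _) (mul_nonneg (hx j) (hx k))
  have hterm : ∀ j ∈ T, x j * ∑ k ∈ s, triangleIndicator G v j k * x k ≤ x j * ∑ k ∈ S, x k := by
    intro j hj
    rw [← hD]
    exact mul_le_mul_of_nonneg_left (hmax j (hTs hj)) (hx j)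
  have hle := Finset.sum_le_sum hterm
  have hprod : ∑ j ∈ T, x j * ∑ k ∈ S, x k = (∑ i ∈ S, x i) * ∑ j ∈ T, x j := by
    rw [← Finset.sum_mul, mul_comm]
  refine ⟨S, T, hST, hU, ?_, fun hpos heq => ?_⟩
  · rw [hQ, hsum]
    rw [hprod] at hle
    nlinarith [hx v]
  · rw [hQ, hsum] at heq
    have hvpos := hpos v
    have h1 : (∑ i ∈ S, x i) * ∑ j ∈ T, x j ≤
        (∑ j ∈ T, x j * ∑ k ∈ s, triangleIndicator G v j k * x k) -
        (∑ j ∈ T, ∑ k ∈ T, triangleIndicator G v j k * (x j * x k)) / 2 := by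
      by_contra! hlt
      nlinarith
    have hTT0 : ∑ j ∈ T, ∑ k ∈ T, triangleIndicator G v j k * (x j * x k) = 0 := by
      rw [hprod] at hle
      linarith
    have heq2 := (Finset.sum_eq_sum_iff_of_le hterm).1 (by rw [hprod] at hle ⊢; linarith)
    have hTTz : ∀ j ∈ T, ∀ k ∈ T, triangleIndicator G v j k = 0 := by
      intro j hj k hk
      have h2 := (Finset.sum_eq_zero_iff_of_nonneg (fun j _ => Finset.sum_nonneg fun k _ =>
        mul_nonneg (triangleIndicator_nonneg G _ _ _) (mul_nonneg (hx j) (hx k)))).1 hTT0 j hj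
      have h3 := (Finset.sum_eq_zero_iff_of_nonneg (fun k _ =>
        mul_nonneg (triangleIndicator_nonneg G _ _ _) (mul_nonneg (hx j) (hx k)))).1 h2 k hk
      rcases mul_eq_zero.1 h3 with h | h
      · exact h
      · exact absurd h (mul_pos (hpos j) (hpos k)).ne'
    intro i hi j hj
    -- In the equality case `j ∈ T` has the full weighted degree of `u` and no link neighbour in
    -- `T`, so with positive weights it must see all of `S`.
    have h4 := mul_left_cancel₀ (hpos j).ne' (heq2 j hj)
    rw [hsplit, Finset.sum_eq_zero (s := T) (fun k hk => by rw [hTTz j hj k hk, zero_mul]),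
      add_zero] at h4
    have h5 := (Finset.sum_eq_sum_iff_of_le (fun k _ =>
      mul_le_of_le_one_left (hx k) (triangleIndicator_le_one G v j k))).1 h4 i hi
    have h6 : triangleIndicator G v j i ≠ 0 := by
      intro h0
      rw [h0, zero_mul] at h5
      exact (hpos i).ne h5
    have h7 := triangle_of_triangleIndicator_ne_zero G h6
    exact ⟨h7.2.1, h7.1, h7.2.2.symm⟩

end Star

/-- AM-GM is applied to `a`, `σ * x i`, `τ * x j` for each pair in `S × T`. The scalings equalize
these three numbers at the extremal vector; since `|S| = σ ^ 3` and `|T| = τ ^ 3`, all cubes acquire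
the same coefficient `(σ * τ) ^ 3`, and one factor `σ * τ` cancels. -/
theorem bipartite_form_le {V : Type*} (a : ℝ) (ha : 0 ≤ a) (x : V → ℝ) (hx : ∀ i, 0 ≤ x i) (S T : Finset V)
    {σ τ : ℝ} (hσ : 0 < σ) (hτ : 0 < τ) (hσS : σ ^ 3 = S.card) (hτT : τ ^ 3 = T.card) :
    3 * a * ((∑ i ∈ S, x i) * ∑ j ∈ T, x j) ≤
        (σ * τ) ^ 2 * (a ^ 3 + ∑ i ∈ S, x i ^ 3 + ∑ j ∈ T, x j ^ 3) ∧
      ((σ * τ) ^ 2 * (a ^ 3 + ∑ i ∈ S, x i ^ 3 + ∑ j ∈ T, x j ^ 3) ≤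
          3 * a * ((∑ i ∈ S, x i) * ∑ j ∈ T, x j) →
        ∀ i ∈ S, ∀ j ∈ T, a = σ * x i ∧ σ * x i = τ * x j) := by
  have hterm : ∀ p ∈ S ×ˢ T, 3 * (a * (σ * x p.1) * (τ * x p.2)) ≤
      a ^ 3 + (σ * x p.1) ^ 3 + (τ * x p.2) ^ 3 := fun p _ =>
    three_mul_le_add_cubes ha (mul_nonneg hσ.le (hx _)) (mul_nonneg hτ.le (hx _))
  have hle := Finset.sum_le_sum hterm
  have e1 : ∑ p ∈ S ×ˢ T, 3 * (a * (σ * x p.1) * (τ * x p.2)) =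
      σ * τ * (3 * a * ((∑ i ∈ S, x i) * ∑ j ∈ T, x j)) := by
    rw [Finset.sum_product, Finset.sum_mul_sum, Finset.mul_sum, Finset.mul_sum]
    refine Finset.sum_congr rfl fun i _ => ?_
    rw [Finset.mul_sum, Finset.mul_sum]
    exact Finset.sum_congr rfl fun j _ => by ring
  have e2 : ∑ p ∈ S ×ˢ T, (a ^ 3 + (σ * x p.1) ^ 3 + (τ * x p.2) ^ 3) =
      σ * τ * ((σ * τ) ^ 2 * (a ^ 3 + ∑ i ∈ S, x i ^ 3 + ∑ j ∈ T, x j ^ 3)) := by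
    rw [Finset.sum_product]
    simp only [Finset.sum_add_distrib, Finset.sum_const, nsmul_eq_mul, mul_pow, ← Finset.mul_sum,
      ← hσS, ← hτT]
    ring
  have hpos : 0 < σ * τ := mul_pos hσ hτ
  constructor
  · rw [e1, e2] at hle
    exact le_of_mul_le_mul_left hle hpos
  · intro h i hi j hj
    have h2 := (Finset.sum_eq_sum_iff_of_le hterm).1
      (le_antisymm hle (by rw [e1, e2]; exact mul_le_mul_of_nonneg_left h hpos.le)) (i, j)
      (Finset.mk_mem_product hi hj)
    exact eq_of_three_mul_eq_add_cubes ha (mul_nonneg hσ.le (hx _)) (mul_nonneg hτ.le (hx _)) h2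

/-! ### Triangles covered by two vertices: comparison with `K₃ ∨ mK₁`. -/

section TwoCover

variable {V : Type*}

/-- The cubic form of `K₃ ∨ mK₁` with weights `a, b, c` on the triangle and `x` elsewhere. -/
theorem core_form_le {a b c : ℝ} (ha : 0 ≤ a) (hb : 0 ≤ b) (hc : 0 ≤ c) (x : V → ℝ)
    (hx : ∀ i, 0 ≤ x i) (s : Finset V) {r : ℝ} (hr : 0 < r)
    (hrs : r ^ 2 + 2 * s.card * r ^ 3 = 3) :
    3 * (a * b * c + (a * b + b * c + a * c) * ∑ w ∈ s, x w) ≤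
        (1 + 2 * s.card * r) * (a ^ 3 + b ^ 3 + c ^ 3 + ∑ w ∈ s, x w ^ 3) ∧
      ((1 + 2 * s.card * r) * (a ^ 3 + b ^ 3 + c ^ 3 + ∑ w ∈ s, x w ^ 3) ≤
          3 * (a * b * c + (a * b + b * c + a * c) * ∑ w ∈ s, x w) →
        a = b ∧ b = c ∧ ∀ w ∈ s, x w = r * a) := by
  have h0 := three_mul_le_add_cubes ha hb hc
  have hxr : ∀ w, 0 ≤ x w / r := fun w => div_nonneg (hx w) hr.le
  have hxw : ∀ w, r * (x w / r) = x w := fun w => mul_div_cancel₀ _ hr.ne'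
  have hab := fun w => three_mul_le_add_cubes ha hb (hxr w)
  have hbc := fun w => three_mul_le_add_cubes hb hc (hxr w)
  have hac := fun w => three_mul_le_add_cubes ha hc (hxr w)
  -- `r` is the ratio of an outer to a core entry of the eigenvector, and `hrs` is the outer
  -- eigenvalue equation. Hence AM-GM is applied to two core weights and `x w / r`, and the cubes of
  -- `x w` get exactly the coefficient `1 + 2mr`.
  have hlam : (1 + 2 * s.card * r) * r ^ 3 = 3 * r := by linear_combination r * hrs
  have hcube : ∀ w, (1 + 2 * s.card * r) * x w ^ 3 = 3 * r * (x w / r) ^ 3 := fun w => by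
    rw [← hlam, mul_assoc _ (r ^ 3), ← mul_pow, hxw]
  have hterm : ∀ w ∈ s, 3 * ((a * b + b * c + a * c) * x w) ≤
      2 * r * (a ^ 3 + b ^ 3 + c ^ 3) + (1 + 2 * s.card * r) * x w ^ 3 := by
    intro w _
    rw [hcube]
    have e2 : 3 * ((a * b + b * c + a * c) * x w) =
        r * (3 * (a * b * (x w / r)) + 3 * (b * c * (x w / r)) + 3 * (a * c * (x w / r))) := by
      linear_combination -3 * (a * b + b * c + a * c) * hxw w
    rw [e2]
    have := mul_le_mul_of_nonneg_left (add_le_add (add_le_add (hab w) (hbc w)) (hac w)) hr.le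
    linarith
  have hle := Finset.sum_le_sum hterm
  have e1 : ∑ w ∈ s, 3 * ((a * b + b * c + a * c) * x w) =
      3 * ((a * b + b * c + a * c) * ∑ w ∈ s, x w) := by
    simp only [← Finset.mul_sum]
  have e2 : ∑ w ∈ s, (2 * r * (a ^ 3 + b ^ 3 + c ^ 3) + (1 + 2 * s.card * r) * x w ^ 3) =
      s.card * (2 * r * (a ^ 3 + b ^ 3 + c ^ 3)) + (1 + 2 * s.card * r) * ∑ w ∈ s, x w ^ 3 := by
    simp only [Finset.sum_add_distrib, Finset.sum_const, nsmul_eq_mul, ← Finset.mul_sum]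
  constructor
  · rw [e1, e2] at hle
    linarith
  · intro h
    have h1 : 3 * (a * b * c) = a ^ 3 + b ^ 3 + c ^ 3 := by
      rw [e1, e2] at hle
      linarith
    obtain ⟨hab', hbc'⟩ := eq_of_three_mul_eq_add_cubes ha hb hc h1
    refine ⟨hab', hbc', fun w hw => ?_⟩
    have h2 := (Finset.sum_eq_sum_iff_of_le hterm).1
      (le_antisymm hle (by rw [e1, e2]; linarith)) w hw
    subst hab' hbc'
    rw [hcube] at h2
    have h3 : 3 * (a * a * (x w / r)) = a ^ 3 + a ^ 3 + (x w / r) ^ 3 := by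
      have h4 : r * (3 * (a * a * (x w / r))) = r * (a ^ 3 + a ^ 3 + (x w / r) ^ 3) := by
        linear_combination h2 / 3 + 3 * a * a * hxw w
      exact mul_left_cancel₀ hr.ne' h4
    rw [(eq_of_three_mul_eq_add_cubes ha ha (hxr w) h3).2, hxw]

/-- Every link edge meets the edge `pr`, and no further vertex of `s` is adjacent to both `p` and
`r`, as `s` is triangle-free. Attaching everything to the heavier end `p` gives a star of at least
the same weight, and recentring it at the heaviest vertex `c` loses nothing. Strict maximality of
`c` and a third vertex make the recentring strict unless `c = p`. -/
theorem link_form_le_of_le [DecidableEq V] (G : SimpleGraph V) (b p r c : V) (s : Finset V)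
    (hp : p ∈ s) (hr : r ∈ s) (hc : c ∈ s) (hpr : G.Adj p r)
    (hfree : ∀ i ∈ s, ∀ j ∈ s, ∀ k ∈ s, ¬(G.Adj i j ∧ G.Adj i k ∧ G.Adj j k))
    (hcover : ∀ j ∈ s, ∀ k ∈ s, G.Adj b j ∧ G.Adj b k ∧ G.Adj j k →
      j = p ∨ j = r ∨ k = p ∨ k = r)
    (x : V → ℝ) (hx : ∀ i, 0 ≤ x i) (hmax : ∀ k ∈ s, x k ≤ x c) (hrp : x r ≤ x p) :
    ∑ j ∈ s, ∑ k ∈ s, triangleIndicator G b j k * (x j * x k) ≤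
        2 * (x c * ∑ k ∈ s.erase c, x k) ∧
      ((∀ i, 0 < x i) → (∀ k ∈ s, k ≠ c → x k < x c) → 3 ≤ s.card →
        2 * (x c * ∑ k ∈ s.erase c, x k) ≤
          ∑ j ∈ s, ∑ k ∈ s, triangleIndicator G b j k * (x j * x k) →
        ∀ k ∈ s, k ≠ c → G.Adj b c ∧ G.Adj b k ∧ G.Adj c k) := by
  set s' := (s.erase p).erase r with hs'
  have hrs : r ∈ s.erase p := Finset.mem_erase.2 ⟨hpr.ne', hr⟩
  have hmem : ∀ k ∈ s', k ≠ r ∧ k ≠ p ∧ k ∈ s := fun k hk => by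
    simpa [hs'] using hk
  have hsym : ∀ j k, triangleIndicator G b j k * (x j * x k) =
      triangleIndicator G b k j * (x k * x j) := fun j k => by
    rw [triangleIndicator_swap_right]; ring
  have hdiag : ∀ j, triangleIndicator G b j j * (x j * x j) = 0 := fun j => by
    rw [triangleIndicator_of_not] <;> simp
  have h1 := sum_sum_insert _ hsym hdiag (Finset.notMem_erase p s)
  have h2 := sum_sum_insert _ hsym hdiag (Finset.notMem_erase r (s.erase p))
  rw [Finset.insert_erase hp] at h1
  rw [Finset.insert_erase hrs] at h2
  have h3 : ∑ j ∈ s', ∑ k ∈ s', triangleIndicator G b j k * (x j * x k) = 0 :=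
    Finset.sum_eq_zero fun j hj => Finset.sum_eq_zero fun k hk => by
      rw [triangleIndicator_of_not, zero_mul]
      intro h
      have := hcover j (hmem j hj).2.2 k (hmem k hk).2.2 h
      have := hmem j hj
      have := hmem k hk
      tauto
  have h4 : ∑ k ∈ s.erase p, triangleIndicator G b p k * (x p * x k) =
      triangleIndicator G b p r * (x p * x r) +
        ∑ k ∈ s', triangleIndicator G b p k * (x p * x k) :=
    (Finset.add_sum_erase _ _ hrs).symm
  have h5 : ∑ k ∈ s.erase p, x k = x r + ∑ k ∈ s', x k := (Finset.add_sum_erase _ _ hrs).symm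
  have hterm : ∀ k ∈ s', triangleIndicator G b p k * (x p * x k) +
      triangleIndicator G b r k * (x r * x k) ≤ x p * x k := by
    intro k hk
    have hk' := hmem k hk
    by_cases h : triangleIndicator G b p k = 0
    · rw [h, zero_mul, zero_add]
      calc _ ≤ 1 * (x r * x k) := mul_le_mul_of_nonneg_right (triangleIndicator_le_one G _ _ _)
            (mul_nonneg (hx _) (hx _))
        _ ≤ _ := by rw [one_mul]; exact mul_le_mul_of_nonneg_right hrp (hx k)
    · have hpk := triangle_of_triangleIndicator_ne_zero G h
      have : triangleIndicator G b r k = 0 := by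
        refine triangleIndicator_of_not G fun h' => ?_
        exact hfree p hp r hr k hk'.2.2 ⟨hpr, hpk.2.2, h'.2.2⟩
      rw [this, zero_mul, add_zero]
      exact mul_le_of_le_one_left (mul_nonneg (hx _) (hx _)) (triangleIndicator_le_one G _ _ _)
  have hle := Finset.sum_le_sum hterm
  rw [Finset.sum_add_distrib, ← Finset.mul_sum] at hle
  have hpr1 : triangleIndicator G b p r * (x p * x r) ≤ x p * x r :=
    mul_le_of_le_one_left (mul_nonneg (hx _) (hx _)) (triangleIndicator_le_one G _ _ _)
  have hQ : ∑ j ∈ s, ∑ k ∈ s, triangleIndicator G b j k * (x j * x k) =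
      2 * (triangleIndicator G b p r * (x p * x r) +
        ∑ k ∈ s', triangleIndicator G b p k * (x p * x k) +
        ∑ k ∈ s', triangleIndicator G b r k * (x r * x k)) := by
    rw [h1, h2, h3, h4]; ring
  have hp_le : ∑ j ∈ s, ∑ k ∈ s, triangleIndicator G b j k * (x j * x k) ≤
      2 * (x p * ∑ k ∈ s.erase p, x k) := by
    rw [hQ, h5]; linarith
  have hSp := Finset.add_sum_erase s x hp
  have hSc := Finset.add_sum_erase s x hc
  have hpc : c ≠ p → ∑ k ∈ s.erase p, x k = x c + ∑ k ∈ (s.erase p).erase c, x k := fun h =>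
    (Finset.add_sum_erase _ _ (Finset.mem_erase.2 ⟨h, hc⟩)).symm
  constructor
  · refine hp_le.trans ?_
    by_cases h : c = p
    · rw [h]
    · have h6 := hpc h
      have h7 : 0 ≤ ∑ k ∈ (s.erase p).erase c, x k := Finset.sum_nonneg fun k _ => hx k
      have h8 : ∑ k ∈ s.erase c, x k = x p + ∑ k ∈ (s.erase p).erase c, x k := by linarith
      rw [h6, h8]
      -- The star at `c` exceeds the star at `p` by `x c - x p` times the weight of the remaining
      -- vertices.
      nlinarith [mul_le_mul_of_nonneg_right (hmax p hp) h7]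
  · intro hpos hstrict hcard heq
    have hcp : c = p := by
      by_contra h
      have h6 := hpc h
      have h7 : 0 < ∑ k ∈ (s.erase p).erase c, x k := by
        refine Finset.sum_pos (fun k _ => hpos k) ?_
        rw [← Finset.card_pos, Finset.card_erase_of_mem (Finset.mem_erase.2 ⟨h, hc⟩),
          Finset.card_erase_of_mem hp]
        omega
      have h8 : ∑ k ∈ s.erase c, x k = x p + ∑ k ∈ (s.erase p).erase c, x k := by linarith
      rw [h8] at heq
      rw [h6] at hp_le
      nlinarith [mul_lt_mul_of_pos_right (hstrict p hp (Ne.symm h)) h7]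
    subst hcp
    rw [hQ, h5] at heq
    have hrc := hstrict r hr hpr.ne'
    have h9 : triangleIndicator G b c r ≠ 0 := by
      intro h0
      rw [h0] at heq
      nlinarith [mul_pos (hpos c) (hpos r)]
    have h10 := (Finset.sum_eq_sum_iff_of_le hterm).1
      (by rw [Finset.sum_add_distrib, ← Finset.mul_sum]; linarith)
    intro k hk hkc
    by_cases hkr : k = r
    · rw [hkr]; exact triangle_of_triangleIndicator_ne_zero G h9
    · refine triangle_of_triangleIndicator_ne_zero G fun h0 => ?_
      have h11 := h10 k (by simp [hs', hkr, hkc, hk])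
      rw [h0, zero_mul, zero_add] at h11
      have h12 := mul_le_of_le_one_left (mul_nonneg (hx r) (hx k)) (triangleIndicator_le_one G b r k)
      have h13 := mul_lt_mul_of_pos_right hrc (hpos k)
      linarith

theorem link_form_le [DecidableEq V] (G : SimpleGraph V) (b p r c : V) (s : Finset V)
    (hp : p ∈ s) (hr : r ∈ s) (hc : c ∈ s) (hpr : G.Adj p r)
    (hfree : ∀ i ∈ s, ∀ j ∈ s, ∀ k ∈ s, ¬(G.Adj i j ∧ G.Adj i k ∧ G.Adj j k))
    (hcover : ∀ j ∈ s, ∀ k ∈ s, G.Adj b j ∧ G.Adj b k ∧ G.Adj j k →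
      j = p ∨ j = r ∨ k = p ∨ k = r)
    (x : V → ℝ) (hx : ∀ i, 0 ≤ x i) (hmax : ∀ k ∈ s, x k ≤ x c) :
    ∑ j ∈ s, ∑ k ∈ s, triangleIndicator G b j k * (x j * x k) ≤
        2 * (x c * ∑ k ∈ s.erase c, x k) ∧
      ((∀ i, 0 < x i) → (∀ k ∈ s, k ≠ c → x k < x c) → 3 ≤ s.card →
        2 * (x c * ∑ k ∈ s.erase c, x k) ≤
          ∑ j ∈ s, ∑ k ∈ s, triangleIndicator G b j k * (x j * x k) →
        ∀ k ∈ s, k ≠ c → G.Adj b c ∧ G.Adj b k ∧ G.Adj c k) := by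
  rcases le_total (x r) (x p) with h | h
  · exact link_form_le_of_le G b p r c s hp hr hc hpr hfree hcover x hx hmax h
  · exact link_form_le_of_le G b r p c s hr hp hc hpr.symm hfree
      (fun j hj k hk hjk => by have := hcover j hj k hk hjk; tauto) x hx hmax h

/-- If the pair `a, b` meets all triangles, but neither `a` nor `b` alone does, and any two triangles
meet, the triangle form is dominated by the one of a join `K₃ ∨ mK₁`. -/
theorem exists_triangleForm_le_core [Fintype V] [DecidableEq V] (G : SimpleGraph V) (a b : V) (hab : a ≠ b)
    (hcov : ∀ i j k, G.Adj i j ∧ G.Adj i k ∧ G.Adj j k →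
      a = i ∨ a = j ∨ a = k ∨ b = i ∨ b = j ∨ b = k)
    (ha : ∃ i j k, (G.Adj i j ∧ G.Adj i k ∧ G.Adj j k) ∧ a ≠ i ∧ a ≠ j ∧ a ≠ k)
    (hb : ∃ i j k, (G.Adj i j ∧ G.Adj i k ∧ G.Adj j k) ∧ b ≠ i ∧ b ≠ j ∧ b ≠ k)
    (hint : TrianglesIntersect G)
    (x : V → ℝ) (hx : ∀ i, 0 ≤ x i) :
    ∃ c, c ≠ a ∧ c ≠ b ∧
      triangleForm G x ≤ 6 * (x a * x b * x c +
        (x a * x b + x b * x c + x a * x c) *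
          ∑ w ∈ ((Finset.univ.erase a).erase b).erase c, x w) ∧
      ((∀ i, 0 < x i) → (∀ k, k ≠ a → k ≠ b → k ≠ c → x k < x c) → 5 ≤ Fintype.card V →
        6 * (x a * x b * x c + (x a * x b + x b * x c + x a * x c) *
          ∑ w ∈ ((Finset.univ.erase a).erase b).erase c, x w) ≤ triangleForm G x →
        ∀ u ∈ ({a, b, c} : Finset V), ∀ w, w ≠ u → G.Adj u w) := by
  set s := (Finset.univ.erase a).erase b with hs
  have hmem : ∀ k, k ∈ s ↔ k ≠ b ∧ k ≠ a := fun k => by simp [hs]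
  have hbm : b ∈ Finset.univ.erase a := by simp [hab.symm]
  have hfree : ∀ i ∈ s, ∀ j ∈ s, ∀ k ∈ s, ¬(G.Adj i j ∧ G.Adj i k ∧ G.Adj j k) := by
    intro i hi j hj k hk h
    have := hcov i j k h
    rw [hmem] at hi hj hk
    tauto
  have hlink : ∀ a b : V, a ≠ b → (∀ i j k, G.Adj i j ∧ G.Adj i k ∧ G.Adj j k →
      a = i ∨ a = j ∨ a = k ∨ b = i ∨ b = j ∨ b = k) →
      (∃ i j k, (G.Adj i j ∧ G.Adj i k ∧ G.Adj j k) ∧ a ≠ i ∧ a ≠ j ∧ a ≠ k) →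
      ∃ p r, (p ≠ b ∧ p ≠ a) ∧ (r ≠ b ∧ r ≠ a) ∧ G.Adj b p ∧ G.Adj b r ∧ G.Adj p r := by
    rintro a b hab hcov ⟨i, j, k, h, h1, h2, h3⟩
    rcases (by have := hcov i j k h; tauto : b = i ∨ b = j ∨ b = k) with rfl | rfl | rfl
    · exact ⟨j, k, ⟨h.1.ne', h2.symm⟩, ⟨h.2.1.ne', h3.symm⟩, h.1, h.2.1, h.2.2⟩
    · exact ⟨i, k, ⟨h.1.ne, h1.symm⟩, ⟨h.2.2.ne', h3.symm⟩, h.1.symm, h.2.2, h.2.1⟩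
    · exact ⟨i, j, ⟨h.2.1.ne, h1.symm⟩, ⟨h.2.2.ne, h2.symm⟩, h.2.1.symm, h.2.2.symm, h.1⟩
  obtain ⟨p, r, hp, hr, hbpr⟩ := hlink a b hab hcov ha
  obtain ⟨p', r', hp', hr', hapr⟩ := hlink b a hab.symm
    (fun i j k h => by have := hcov i j k h; tauto) hb
  have hps : p ∈ s := (hmem p).2 hp
  have hrs : r ∈ s := (hmem r).2 hr
  have hps' : p' ∈ s := (hmem p').2 hp'.symm
  have hrs' : r' ∈ s := (hmem r').2 hr'.symm
  obtain ⟨c, hc, hmax⟩ := s.exists_max_image x ⟨p, hps⟩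
  have hcs := (hmem c).1 hc
  -- Triangles through `b` alone must meet the triangle `a p' r'`, hence its edge `p' r'`;
  -- symmetrically for `a` and `pr`. Both stars share the centre `c`.
  have Lb := link_form_le G b p' r' c s hps' hrs' hc hapr.2.2 hfree (fun j hj k hk h => by
    have := hint b j k a p' r' h hapr
    rw [hmem] at hj hk
    grind) x hx hmax
  have La := link_form_le G a p r c s hps hrs hc hbpr.2.2 hfree (fun j hj k hk h => by
    have := hint a j k b p r h hbpr
    rw [hmem] at hj hk
    grind) x hx hmax
  -- Ordered triangles split into those through both `a` and `b`, those through `a` only and those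
  -- through `b` only.
  have hQ : triangleForm G x =
      6 * ∑ k ∈ s, triangleIndicator G a b k * (x a * x b * x k) +
      3 * (x a * ∑ j ∈ s, ∑ k ∈ s, triangleIndicator G a j k * (x j * x k)) +
      3 * (x b * ∑ j ∈ s, ∑ k ∈ s, triangleIndicator G b j k * (x j * x k)) := by
    have h1 := sum_sum_insert (fun j k => triangleIndicator G a j k * (x a * x j * x k))
      (fun j k => by rw [triangleIndicator_swap_right]; ring)
      (fun j => by rw [triangleIndicator_of_not] <;> simp) (Finset.notMem_erase b (Finset.univ.erase a))
    have h2 := sum_sum_sum_insert (fun i j k => triangleIndicator G i j k * (x i * x j * x k))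
      (fun i j k => by rw [triangleIndicator_swap_left]; ring)
      (fun i j k => by rw [triangleIndicator_swap_right]; ring)
      (fun i j => by rw [triangleIndicator_of_not] <;> simp)
      (Finset.notMem_erase b (Finset.univ.erase a))
    rw [Finset.insert_erase hbm] at h1 h2
    have h3 : ∑ i ∈ s, ∑ j ∈ s, ∑ k ∈ s, triangleIndicator G i j k * (x i * x j * x k) = 0 :=
      Finset.sum_eq_zero fun i hi => Finset.sum_eq_zero fun j hj => Finset.sum_eq_zero fun k hk => by
        rw [triangleIndicator_of_not G (hfree i hi j hj k hk), zero_mul]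
    rw [triangleForm_eq_insert G x a, h1, h2, ← hs, h3]
    have h4 : ∀ v : V, x v * ∑ j ∈ s, ∑ k ∈ s, triangleIndicator G v j k * (x j * x k) =
        ∑ j ∈ s, ∑ k ∈ s, triangleIndicator G v j k * (x v * x j * x k) := by
      intro v
      simp only [Finset.mul_sum]
      exact Finset.sum_congr rfl fun j _ => Finset.sum_congr rfl fun k _ => by ring
    rw [h4, h4]
    ring
  have hterm : ∀ k ∈ s, triangleIndicator G a b k * (x a * x b * x k) ≤ x a * x b * x k :=
    fun k _ => mul_le_of_le_one_left (mul_nonneg (mul_nonneg (hx _) (hx _)) (hx _))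
      (triangleIndicator_le_one G _ _ _)
  have hle := Finset.sum_le_sum hterm
  have hsum : ∑ k ∈ s, x a * x b * x k = x a * x b * (x c + ∑ w ∈ s.erase c, x w) := by
    rw [← Finset.mul_sum, Finset.add_sum_erase _ _ hc]
  refine ⟨c, hcs.2, hcs.1, ?_, fun hpos hstrict hcard heq => ?_⟩
  · rw [hQ]
    have := mul_le_mul_of_nonneg_left La.1 (hx a)
    have := mul_le_mul_of_nonneg_left Lb.1 (hx b)
    linarith
  · rw [hQ] at heq
    have ea := mul_le_mul_of_nonneg_left La.1 (hx a)
    have eb := mul_le_mul_of_nonneg_left Lb.1 (hx b)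
    have hscard : 3 ≤ s.card := by
      rw [Finset.card_erase_of_mem hbm, Finset.card_erase_of_mem (Finset.mem_univ a),
        Finset.card_univ]
      omega
    have hst : ∀ k ∈ s, k ≠ c → x k < x c := fun k hk hkc =>
      hstrict k ((hmem k).1 hk).2 ((hmem k).1 hk).1 hkc
    have ha' := La.2 hpos hst hscard (le_of_mul_le_mul_left (by linarith) (hpos a))
    have hb' := Lb.2 hpos hst hscard (le_of_mul_le_mul_left (by linarith) (hpos b))
    have hab' : ∀ k ∈ s, G.Adj a b ∧ G.Adj a k ∧ G.Adj b k := by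
      intro k hk
      have h1 := (Finset.sum_eq_sum_iff_of_le hterm).1 (by linarith) k hk
      refine triangle_of_triangleIndicator_ne_zero G fun h0 => ?_
      rw [h0, zero_mul] at h1
      exact (mul_pos (mul_pos (hpos a) (hpos b)) (hpos k)).ne h1
    intro u hu w hwu
    simp only [Finset.mem_insert, Finset.mem_singleton] at hu
    have hcc := hab' c hc
    by_cases hwa : w = a
    · subst hwa
      rcases hu with rfl | rfl | rfl
      · exact absurd rfl hwu
      · exact hcc.1.symm
      · exact hcc.2.1.symm
    by_cases hwb : w = b
    · subst hwb
      rcases hu with rfl | rfl | rfl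
      · exact hcc.1
      · exact absurd rfl hwu
      · exact hcc.2.2.symm
    have hw : w ∈ s := (hmem w).2 ⟨hwb, hwa⟩
    rcases hu with rfl | rfl | rfl
    · exact (hab' w hw).2.1
    · exact (hab' w hw).2.2
    · exact (ha' w hw hwu).2.2

end TwoCover

/-! ### The complete graph. -/

section Complete

variable {V : Type*}

theorem sum_sum_triangleIndicator_top [DecidableEq V] (s : Finset V) (h2 : 2 ≤ s.card) {i : V}
    (hi : i ∈ s) : ∑ j ∈ s, ∑ k ∈ s, triangleIndicator (⊤ : SimpleGraph V) i j k =
      ((s.card : ℝ) - 1) * (s.card - 2) := by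
  have h1 : ∀ j ∈ s, ∑ k ∈ s, triangleIndicator (⊤ : SimpleGraph V) i j k =
      if j ≠ i then (s.card : ℝ) - 2 else 0 := by
    intro j hj
    split_ifs with hji
    · have : ∀ k ∈ s, triangleIndicator (⊤ : SimpleGraph V) i j k =
          if k ∈ (s.erase i).erase j then 1 else 0 := by
        intro k hk
        by_cases h : k ∈ (s.erase i).erase j
        · rw [if_pos h, triangleIndicator_of_triangle]
          simp only [Finset.mem_erase] at h
          exact ⟨hji.symm, h.2.1.symm, h.1.symm⟩
        · rw [if_neg h, triangleIndicator_of_not]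
          simp only [Finset.mem_erase, SimpleGraph.top_adj] at h ⊢
          tauto
      have hsub : (s.erase i).erase j ⊆ s :=
        (Finset.erase_subset _ _).trans (Finset.erase_subset _ _)
      rw [Finset.sum_congr rfl this, Finset.sum_ite_mem, Finset.inter_eq_right.2 hsub,
        Finset.sum_const, Finset.card_erase_of_mem (Finset.mem_erase.2 ⟨hji, hj⟩),
        Finset.card_erase_of_mem hi, nsmul_eq_mul, mul_one, Nat.sub_sub, Nat.cast_sub h2]
      norm_num
    · refine Finset.sum_eq_zero fun k _ => triangleIndicator_of_not _ ?_
      rw [not_not.1 hji]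
      simp
  rw [Finset.sum_congr rfl h1, ← Finset.sum_filter, Finset.filter_ne', Finset.sum_const,
    Finset.card_erase_of_mem hi, nsmul_eq_mul, Nat.cast_sub (by omega)]
  norm_num

/-- AM-GM on every ordered triple of distinct vertices: each vertex occupies a given position in
`(|s| - 1)(|s| - 2)` of them. In the equality case a triple that is not a triangle has all weights
zero. -/
theorem complete_form_le [DecidableEq V] (G : SimpleGraph V) (s : Finset V) (h3 : 3 ≤ s.card)
    (x : V → ℝ) (hx : ∀ i, 0 ≤ x i) :
    ∑ i ∈ s, ∑ j ∈ s, ∑ k ∈ s, triangleIndicator G i j k * (x i * x j * x k) ≤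
        ((s.card : ℝ) - 1) * (s.card - 2) * ∑ i ∈ s, x i ^ 3 ∧
      (((s.card : ℝ) - 1) * (s.card - 2) * ∑ i ∈ s, x i ^ 3 ≤
          ∑ i ∈ s, ∑ j ∈ s, ∑ k ∈ s, triangleIndicator G i j k * (x i * x j * x k) →
        ∀ i ∈ s, ∀ j ∈ s, i ≠ j → x i = x j ∧ (0 < x i → G.Adj i j)) := by
  set t := triangleIndicator (⊤ : SimpleGraph V) with ht
  have hGt : ∀ i j k, triangleIndicator G i j k ≤ t i j k := by
    intro i j k
    by_cases h : triangleIndicator G i j k = 0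
    · rw [h]; exact triangleIndicator_nonneg _ _ _ _
    · have h' := triangle_of_triangleIndicator_ne_zero G h
      rw [ht, triangleIndicator_of_triangle (⊤ : SimpleGraph V) (by simp [h'.1.ne, h'.2.1.ne, h'.2.2.ne])]
      exact triangleIndicator_le_one _ _ _ _
  have hterm : ∀ p ∈ s ×ˢ s ×ˢ s,
      triangleIndicator G p.1 p.2.1 p.2.2 * (x p.1 * x p.2.1 * x p.2.2) ≤
        t p.1 p.2.1 p.2.2 * ((x p.1 ^ 3 + x p.2.1 ^ 3 + x p.2.2 ^ 3) / 3) := by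
    intro p _
    have h := three_mul_le_add_cubes (hx p.1) (hx p.2.1) (hx p.2.2)
    exact mul_le_mul (hGt _ _ _) (by linarith)
      (mul_nonneg (mul_nonneg (hx _) (hx _)) (hx _)) (triangleIndicator_nonneg _ _ _ _)
  have hle := Finset.sum_le_sum hterm
  have e1 : ∑ p ∈ s ×ˢ s ×ˢ s,
      triangleIndicator G p.1 p.2.1 p.2.2 * (x p.1 * x p.2.1 * x p.2.2) =
      ∑ i ∈ s, ∑ j ∈ s, ∑ k ∈ s, triangleIndicator G i j k * (x i * x j * x k) := by
    simp only [Finset.sum_product]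
  have hcount : ∑ i ∈ s, ∑ j ∈ s, ∑ k ∈ s, t i j k * x i ^ 3 =
      ((s.card : ℝ) - 1) * (s.card - 2) * ∑ i ∈ s, x i ^ 3 := by
    rw [Finset.mul_sum]
    refine Finset.sum_congr rfl fun i hi => ?_
    simp only [← Finset.sum_mul]
    rw [sum_sum_triangleIndicator_top s (by omega) hi]
  have hcount2 : ∑ i ∈ s, ∑ j ∈ s, ∑ k ∈ s, t i j k * x j ^ 3 =
      ((s.card : ℝ) - 1) * (s.card - 2) * ∑ i ∈ s, x i ^ 3 := by
    rw [Finset.sum_comm, ← hcount]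
    refine Finset.sum_congr rfl fun i _ => Finset.sum_congr rfl fun j _ =>
      Finset.sum_congr rfl fun k _ => by rw [ht, triangleIndicator_swap_left]
  have hcount3 : ∑ i ∈ s, ∑ j ∈ s, ∑ k ∈ s, t i j k * x k ^ 3 =
      ((s.card : ℝ) - 1) * (s.card - 2) * ∑ i ∈ s, x i ^ 3 := by
    rw [← hcount2]
    refine Finset.sum_congr rfl fun i _ => ?_
    rw [Finset.sum_comm]
    refine Finset.sum_congr rfl fun j _ =>
      Finset.sum_congr rfl fun k _ => by rw [ht, triangleIndicator_swap_right]
  have e2 : ∑ p ∈ s ×ˢ s ×ˢ s, t p.1 p.2.1 p.2.2 * ((x p.1 ^ 3 + x p.2.1 ^ 3 + x p.2.2 ^ 3) / 3) =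
      ((s.card : ℝ) - 1) * (s.card - 2) * ∑ i ∈ s, x i ^ 3 := by
    have : ∀ i j k, t i j k * ((x i ^ 3 + x j ^ 3 + x k ^ 3) / 3) =
        (t i j k * x i ^ 3 + t i j k * x j ^ 3 + t i j k * x k ^ 3) / 3 := fun i j k => by ring
    simp only [Finset.sum_product, this, ← Finset.sum_div, Finset.sum_add_distrib]
    rw [hcount, hcount2, hcount3]
    ring
  constructor
  · rwa [e1, e2] at hle
  · intro h i hi j hj hij
    have hne : ((s.erase i).erase j).Nonempty := by
      rw [← Finset.card_pos, Finset.card_erase_of_mem (Finset.mem_erase.2 ⟨hij.symm, hj⟩),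
        Finset.card_erase_of_mem hi]
      omega
    obtain ⟨k, hk⟩ := hne
    simp only [Finset.mem_erase] at hk
    have h1 := (Finset.sum_eq_sum_iff_of_le hterm).1 (le_antisymm hle (by rw [e1, e2]; exact h))
      (i, j, k) (by simp [hi, hj, hk.2.2])
    have htop : t i j k = 1 := triangleIndicator_of_triangle _ ⟨hij, hk.2.1.symm, hk.1.symm⟩
    simp only [htop, one_mul] at h1
    by_cases h0 : triangleIndicator G i j k = 0
    · rw [h0, zero_mul] at h1
      have hi0 := pow_nonneg (hx i) 3
      have hj0 := pow_nonneg (hx j) 3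
      have hk0 := pow_nonneg (hx k) 3
      have hi1 : x i = 0 := by
        have : x i ^ 3 = 0 := by linarith
        exact pow_eq_zero_iff (by norm_num) |>.1 this
      have hj1 : x j = 0 := by
        have : x j ^ 3 = 0 := by linarith
        exact pow_eq_zero_iff (by norm_num) |>.1 this
      exact ⟨by rw [hi1, hj1], fun h => absurd hi1 h.ne'⟩
    · have hT := triangle_of_triangleIndicator_ne_zero G h0
      rw [triangleIndicator_of_triangle G hT, one_mul] at h1
      exact ⟨(eq_of_three_mul_eq_add_cubes (hx i) (hx j) (hx k) (by linarith)).1, fun _ => hT.1⟩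

end Complete

/-! ### Structure of graphs with pairwise intersecting triangles. -/

section Cover

variable {V : Type*} {G : SimpleGraph V}

/-- A triangle avoiding `a` and `b` still has to meet `abc`, so it passes through `c`. -/
theorem TrianglesIntersect.exists_apex (hG : TrianglesIntersect G)
    (hcov : ∀ a b, ∃ i j k, (G.Adj i j ∧ G.Adj i k ∧ G.Adj j k) ∧
      (a ≠ i ∧ a ≠ j ∧ a ≠ k) ∧ b ≠ i ∧ b ≠ j ∧ b ≠ k)
    {a b c : V} (h : G.Adj a b ∧ G.Adj a c ∧ G.Adj b c) :
    ∃ p q, (G.Adj c p ∧ G.Adj c q ∧ G.Adj p q) ∧ p ≠ a ∧ p ≠ b ∧ q ≠ a ∧ q ≠ b := by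
  obtain ⟨i, j, k, ht, h1, h2⟩ := hcov a b
  rcases (by have := hG a b c i j k h ht; tauto : i = c ∨ j = c ∨ k = c) with rfl | rfl | rfl
  · exact ⟨j, k, ht, h1.2.1.symm, h2.2.1.symm, h1.2.2.symm, h2.2.2.symm⟩
  · exact ⟨i, k, ⟨ht.1.symm, ht.2.2, ht.2.1⟩, h1.1.symm, h2.1.symm, h1.2.2.symm, h2.2.2.symm⟩
  · exact ⟨i, j, ⟨ht.2.1.symm, ht.2.2.symm, ht.1⟩, h1.1.symm, h2.1.symm, h1.2.1.symm, h2.2.1.symm⟩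

/-- Extends a triangle to a `K₄`. Each vertex of `abc` is the apex of a triangle meeting `abc` only
there, and these three triangles pairwise intersect outside `abc`. If they had no common outer
vertex and met in three different ones, those would form a triangle disjoint from `abc`. -/
theorem TrianglesIntersect.exists_common_neighbor (hG : TrianglesIntersect G)
    (hcov : ∀ a b, ∃ i j k, (G.Adj i j ∧ G.Adj i k ∧ G.Adj j k) ∧
      (a ≠ i ∧ a ≠ j ∧ a ≠ k) ∧ b ≠ i ∧ b ≠ j ∧ b ≠ k)
    {a b c : V} (h : G.Adj a b ∧ G.Adj a c ∧ G.Adj b c) :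
    ∃ d, G.Adj a d ∧ G.Adj b d ∧ G.Adj c d := by
  obtain ⟨p₁, q₁, h₁, n₁⟩ := hG.exists_apex hcov (a := b) (b := c) (c := a)
    ⟨h.2.2, h.1.symm, h.2.1.symm⟩
  obtain ⟨p₂, q₂, h₂, n₂⟩ := hG.exists_apex hcov (a := a) (b := c) (c := b)
    ⟨h.2.1, h.1, h.2.2.symm⟩
  obtain ⟨p₃, q₃, h₃, n₃⟩ := hG.exists_apex hcov (a := a) (b := b) (c := c) h
  have ha := h₁.1.ne
  have ha' := h₁.2.1.ne
  have hb := h₂.1.ne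
  have hb' := h₂.2.1.ne
  have hc := h₃.1.ne
  have hc' := h₃.2.1.ne
  have key : ∀ p q r, (G.Adj a p ∧ G.Adj a q ∧ G.Adj p q) → (G.Adj b p ∧ G.Adj b r ∧ G.Adj p r) →
      p ≠ c → q ≠ b → q ≠ c → r ≠ a → r ≠ c → ∃ d, G.Adj a d ∧ G.Adj b d ∧ G.Adj c d := by
    intro p q r hp hr hpc hqb hqc hra hrc
    have k₁ := hG a p q c p₃ q₃ hp h₃
    have k₂ := hG b p r c p₃ q₃ hr h₃
    have k₃ : ¬(G.Adj p q ∧ G.Adj p r ∧ G.Adj q r) := fun h' => by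
      have := hG a b c p q r h h'
      have := hp.1.ne
      have := hr.1.ne
      have := hp.2.1.ne
      have := hr.2.1.ne
      grind
    by_cases e₁ : p₃ = p
    · exact ⟨p, hp.1, hr.1, e₁ ▸ h₃.1⟩
    by_cases e₂ : q₃ = p
    · exact ⟨p, hp.1, hr.1, e₂ ▸ h₃.2.1⟩
    have l₁ : p₃ = q ∨ q₃ = q := by
      have := h.2.1.ne'
      grind
    have l₂ : p₃ = r ∨ q₃ = r := by
      have := h.2.2.ne'
      grind
    rcases l₁ with rfl | rfl <;> rcases l₂ with e | e
    · exact ⟨p₃, hp.2.1, e ▸ hr.2.1, h₃.1⟩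
    · subst e; exact absurd ⟨hp.2.2, hr.2.2, h₃.2.2⟩ k₃
    · subst e; exact absurd ⟨hp.2.2, hr.2.2, h₃.2.2.symm⟩ k₃
    · exact ⟨q₃, hp.2.1, e ▸ hr.2.1, h₃.2.1⟩
  have k := hG a p₁ q₁ b p₂ q₂ h₁ h₂
  have hab := h.1.ne
  rcases (by grind : p₂ = p₁ ∨ p₂ = q₁ ∨ q₂ = p₁ ∨ q₂ = q₁) with rfl | rfl | rfl | rfl
  · exact key p₂ q₁ q₂ h₁ h₂ (by grind) (by grind) (by grind) (by grind) (by grind)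
  · exact key p₂ p₁ q₂ ⟨h₁.2.1, h₁.1, h₁.2.2.symm⟩ h₂ (by grind) (by grind) (by grind) (by grind)
      (by grind)
  · exact key q₂ q₁ p₂ h₁ ⟨h₂.2.1, h₂.1, h₂.2.2.symm⟩ (by grind) (by grind) (by grind) (by grind)
      (by grind)
  · exact key q₂ p₁ p₂ ⟨h₁.2.1, h₁.1, h₁.2.2.symm⟩ ⟨h₂.2.1, h₂.1, h₂.2.2.symm⟩ (by grind)
      (by grind) (by grind) (by grind) (by grind)

/-- A graph with intersecting triangles that cannot be covered by two vertices contains a `K₅`. -/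
theorem TrianglesIntersect.exists_isNClique_five [Nonempty V] (hG : TrianglesIntersect G)
    (hcov : ∀ a b, ∃ i j k, (G.Adj i j ∧ G.Adj i k ∧ G.Adj j k) ∧
      (a ≠ i ∧ a ≠ j ∧ a ≠ k) ∧ b ≠ i ∧ b ≠ j ∧ b ≠ k) : ∃ s : Finset V, G.IsNClique 5 s := by
  classical
  obtain ⟨a, b, c, h, -⟩ := hcov (Classical.arbitrary V) (Classical.arbitrary V)
  obtain ⟨d, had, hbd, hcd⟩ := hG.exists_common_neighbor hcov h
  -- In a `K₄`, a triangle through `c` avoiding `a` and `b` must meet `abd`, so it contains the edge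
  -- `cd`.
  have key : ∀ a b c d : V, G.Adj a b → G.Adj a c → G.Adj a d → G.Adj b c → G.Adj b d →
      G.Adj c d → ∃ e, G.Adj c e ∧ G.Adj d e ∧ e ≠ a ∧ e ≠ b := by
    intro a b c d hab hac had hbc hbd hcd
    obtain ⟨p, q, h', n⟩ := hG.exists_apex hcov (a := a) (b := b) (c := c) ⟨hab, hac, hbc⟩
    have hd := hG a b d c p q ⟨hab, had, hbd⟩ h'
    have := hac.ne'
    have := hbc.ne'
    have := hcd.ne
    rcases (by tauto : p = d ∨ q = d) with rfl | rfl
    · exact ⟨q, h'.2.1, h'.2.2, n.2.2⟩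
    · exact ⟨p, h'.1, h'.2.2.symm, n.1, n.2.1⟩
  obtain ⟨e, hce, hde, hea, heb⟩ := key a b c d h.1 h.2.1 had h.2.2 hbd hcd
  obtain ⟨e', hae, hbe, hec, hed⟩ := key c d a b hcd h.2.1.symm h.2.2.symm had.symm hbd.symm h.1
  -- The triangles `cde` and `abe'` can meet only in their third vertices.
  have hee : e' = e := by
    have h1 := hG c d e a b e' ⟨hcd, hce, hde⟩ ⟨h.1, hae, hbe⟩
    have := h.2.1.ne
    have := h.2.2.ne
    have := had.ne
    have := hbd.ne
    have := hea.symm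
    have := heb.symm
    tauto
  subst hee
  refine ⟨{a, b, c, d, e'}, ?_⟩
  refine ((SimpleGraph.is3Clique_triple_iff.2 ⟨hcd, hce, hde⟩).insert (a := b) ?_).insert (a := a) ?_
  · simp [h.2.2, hbd, hbe]
  · simp [h.1, h.2.1, had, hae]

/-- A triangle with a vertex outside `s` uses at most two vertices of `s`; the other three span a
disjoint triangle. -/
theorem TrianglesIntersect.mem_of_isNClique_five (hG : TrianglesIntersect G) {s : Finset V}
    (hs : G.IsNClique 5 s) {i j k : V} (h : G.Adj i j ∧ G.Adj i k ∧ G.Adj j k) :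
    i ∈ s ∧ j ∈ s ∧ k ∈ s := by
  classical
  have key : ∀ i j k, (G.Adj i j ∧ G.Adj i k ∧ G.Adj j k) → i ∈ s := by
    intro i j k h
    by_contra hi
    have hcard : 2 < ((s.erase j).erase k).card := by
      have h1 := Finset.pred_card_le_card_erase (s := s) (a := j)
      have h2 := Finset.pred_card_le_card_erase (s := s.erase j) (a := k)
      have := hs.card_eq
      omega
    obtain ⟨a, b, c, ha, hb, hc, hab, hac, hbc⟩ := Finset.two_lt_card_iff.1 hcard
    simp only [Finset.mem_erase] at ha hb hc
    have h3 := hG i j k a b c h ⟨hs.isClique ha.2.2 hb.2.2 hab, hs.isClique ha.2.2 hc.2.2 hac,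
      hs.isClique hb.2.2 hc.2.2 hbc⟩
    have : a ≠ i := fun h => hi (h ▸ ha.2.2)
    have : b ≠ i := fun h => hi (h ▸ hb.2.2)
    have : c ≠ i := fun h => hi (h ▸ hc.2.2)
    tauto
  exact ⟨key i j k h, key j i k ⟨h.1.symm, h.2.2, h.2.1⟩, key k i j ⟨h.2.1.symm, h.2.2.symm, h.1⟩⟩

theorem trianglesIntersect_of_free (h : twoK3.Free G) : TrianglesIntersect G := by
  intro i j k i' j' k' ht ht'
  by_contra hne
  push Not at hne
  refine h ⟨⟨⟨Sum.elim ![i, j, k] ![i', j', k'], ?_⟩, ?_⟩⟩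
  · rintro (a | a) (b | b) hab
    · fin_cases a <;> fin_cases b <;> simp_all [SimpleGraph.adj_comm]
    · simp at hab
    · simp at hab
    · fin_cases a <;> fin_cases b <;> simp_all [SimpleGraph.adj_comm]
  · refine Function.Injective.sumElim ?_ ?_ ?_
    · intro a b hab
      fin_cases a <;> fin_cases b <;>
        simp_all [ht.1.ne, ht.1.ne', ht.2.1.ne, ht.2.1.ne', ht.2.2.ne, ht.2.2.ne']
    · intro a b hab
      fin_cases a <;> fin_cases b <;>
        simp_all [ht'.1.ne, ht'.1.ne', ht'.2.1.ne, ht'.2.1.ne', ht'.2.2.ne, ht'.2.2.ne']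
    · intro a b
      fin_cases a <;> fin_cases b <;> simp <;> grind

theorem free_of_trianglesIntersect (h : TrianglesIntersect G) : twoK3.Free G := by
  rintro ⟨f⟩
  have hadj : ∀ u v, twoK3.Adj u v → G.Adj (f u) (f v) := fun u v h => f.toHom.map_adj h
  have hne : ∀ u v, u ≠ v → f u ≠ f v := fun u v h h' => h (f.injective h')
  have := h (f (.inl 0)) (f (.inl 1)) (f (.inl 2)) (f (.inr 0)) (f (.inr 1)) (f (.inr 2))
    ⟨hadj _ _ (by simp), hadj _ _ (by simp), hadj _ _ (by simp)⟩
    ⟨hadj _ _ (by simp), hadj _ _ (by simp), hadj _ _ (by simp)⟩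
  rcases this with h | h | h | h | h | h | h | h | h <;> exact hne _ _ (by simp) h

end Cover

/-! ### Isomorphisms from vertex colourings. -/

section Iso

/-- Two graphs whose adjacency is determined by vertex colours, with the same rule and the same
colour class sizes, are isomorphic. -/
theorem nonempty_iso_of_coloring {V W ι : Type*} [Fintype V] [Fintype W] [DecidableEq ι]
    {G : SimpleGraph V} {H : SimpleGraph W} (f : V → ι) (g : W → ι) (R : ι → ι → Prop)
    (hG : ∀ u v, G.Adj u v ↔ u ≠ v ∧ R (f u) (f v)) (hH : ∀ u v, H.Adj u v ↔ u ≠ v ∧ R (g u) (g v))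
    (hcard : ∀ c, Fintype.card {v // f v = c} = Fintype.card {w // g w = c}) :
    Nonempty (G ≃g H) := by
  let e : V ≃ W := (Equiv.sigmaFiberEquiv f).symm.trans
    ((Equiv.sigmaCongrRight fun c => Fintype.equivOfCardEq (hcard c)).trans
      (Equiv.sigmaFiberEquiv g))
  have he : ∀ v, g (e v) = f v := fun v =>
    (Fintype.equivOfCardEq (hcard (f v)) ⟨v, rfl⟩).2
  refine ⟨⟨e, ?_⟩⟩
  intro u v
  rw [hG, hH, he, he, Ne, e.injective.eq_iff]

end Iso

/-! ### The extremal joins: intersecting triangles and explicit eigenvectors. -/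

section Join

theorem join_adj_inl {V W : Type*} (G : SimpleGraph V) (H : SimpleGraph W) (u v : V) :
    (join G H).Adj (.inl u) (.inl v) ↔ G.Adj u v := by simp [join]

theorem join_adj_inr {V W : Type*} (G : SimpleGraph V) (H : SimpleGraph W) (u v : W) :
    (join G H).Adj (.inr u) (.inr v) ↔ H.Adj u v := by simp [join]

theorem join_adj_inl_inr {V W : Type*} (G : SimpleGraph V) (H : SimpleGraph W) (u : V) (v : W) :
    (join G H).Adj (.inl u) (.inr v) := by simp [join]

theorem join_adj_inr_inl {V W : Type*} (G : SimpleGraph V) (H : SimpleGraph W) (u : V) (v : W) :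
    (join G H).Adj (.inr v) (.inl u) := by simp [join]

theorem trianglesIntersect_core (m : ℕ) : TrianglesIntersect (join (K 3) (isolated m)) := by
  have h3 : ∀ a b c d : Fin 3, a ≠ b → c ≠ d → a = c ∨ a = d ∨ b = c ∨ b = d := by decide
  rintro (i | i) (j | j) (k | k) (i' | i') (j' | j') (k' | k') h h' <;>
    simp only [join_adj_inl, join_adj_inr, join_adj_inl_inr, join_adj_inr_inl, SimpleGraph.top_adj,
      SimpleGraph.bot_adj, true_and, and_true, and_false] at h h' <;>
    simp only [Sum.inl.injEq, Sum.inr.injEq, reduceCtorEq, false_or, or_false]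
  all_goals grind

theorem trianglesIntersect_of_cover {V : Type*} {G : SimpleGraph V} (v : V)
    (h : ∀ i j k, G.Adj i j ∧ G.Adj i k ∧ G.Adj j k → v = i ∨ v = j ∨ v = k) :
    TrianglesIntersect G := by
  intro i j k i' j' k' ht ht'
  have := h i j k ht
  have := h i' j' k' ht'
  grind

theorem trianglesIntersect_join_turanGraph (N : ℕ) :
    TrianglesIntersect (join (K 1) (SimpleGraph.turanGraph N 2)) := by
  refine trianglesIntersect_of_cover (Sum.inl 0) ?_
  rintro (i | i) (j | j) (k | k) h
  all_goals try simp [Subsingleton.elim i 0]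
  all_goals try simp [Subsingleton.elim j 0]
  all_goals try simp [Subsingleton.elim k 0]
  simp only [join_adj_inr, SimpleGraph.turanGraph_adj] at h
  omega

/-- The eigenvector is 1 on the triangle and `r` elsewhere: the core equations define the
eigenvalue, and the outer equation is `hrs`. -/
theorem le_cliqueSpectralRadius_core (m : ℕ) {r : ℝ} (hrs : r ^ 2 + 2 * m * r ^ 3 = 3) :
    1 + 2 * m * r ≤ cliqueSpectralRadius 3 (join (K 3) (isolated m)) := by
  refine le_cliqueSpectralRadius_of_eigenvector _ (Sum.elim (fun _ => 1) (fun _ => r)) ?_ ?_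
  · intro h
    simpa using congrFun h (Sum.inl 0)
  · rintro (i | i)
    · fin_cases i <;>
      simp [Fintype.sum_sum_type, Fin.sum_univ_three, triangleIndicator, join_adj_inl,
        join_adj_inr, join_adj_inl_inr, join_adj_inr_inl] <;> ring
    · simp [Fintype.sum_sum_type, Fin.sum_univ_three, triangleIndicator, join_adj_inl,
        join_adj_inr, join_adj_inr_inl]
      linear_combination -2 * hrs

theorem card_even_fin (N : ℕ) :
    (Finset.univ.filter fun j : Fin N => (j : ℕ) % 2 = 0).card = (N + 1) / 2 := by
  induction N with
  | zero => simp
  | succ N ih =>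
    rw [Finset.card_filter] at ih ⊢
    rw [Fin.sum_univ_castSucc]
    simp only [Fin.val_castSucc, Fin.val_last, ih]
    split_ifs <;> omega

theorem card_odd_fin (N : ℕ) :
    (Finset.univ.filter fun j : Fin N => ¬((j : ℕ) % 2 = 0)).card = N / 2 := by
  have h := Finset.card_filter_add_card_filter_not (s := (Finset.univ : Finset (Fin N)))
    (fun j : Fin N => (j : ℕ) % 2 = 0)
  rw [card_even_fin, Finset.card_univ, Fintype.card_fin] at h
  omega

theorem exists_cube_root {a : ℝ} (ha : 0 < a) : ∃ b : ℝ, 0 < b ∧ b ^ 3 = a :=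
  ⟨a ^ (1 / 3 : ℝ), by positivity, by
    rw [← Real.rpow_natCast, ← Real.rpow_mul ha.le]; norm_num⟩

/-- The eigenvector is 1 at the apex and the inverse cube root of the part size on each part, the
equality vector of `bipartite_form_le`. Even labels form the larger part. -/
theorem le_cliqueSpectralRadius_join_turanGraph (N : ℕ) (hN : 2 ≤ N) {κ : ℝ} (hκ : 0 < κ)
    (hκN : κ ^ 3 = ((N + 1) / 2 * (N / 2) : ℕ)) :
    κ ^ 2 ≤ cliqueSpectralRadius 3 (join (K 1) (SimpleGraph.turanGraph N 2)) := by
  set s := (N + 1) / 2 with hs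
  set t := N / 2 with ht
  obtain ⟨σ, hσ, hσs⟩ := exists_cube_root (a := (s : ℝ)) (by
    have : 0 < s := by omega
    exact_mod_cast this)
  obtain ⟨τ, hτ, hτt⟩ := exists_cube_root (a := (t : ℝ)) (by
    have : 0 < t := by omega
    exact_mod_cast this)
  have hστ : κ = σ * τ := by
    refine (pow_left_inj₀ hκ.le (by positivity) (by norm_num : (3 : ℕ) ≠ 0)).1 ?_
    rw [hκN, mul_pow, hσs, hτt]
    push_cast
    ring
  set y : Fin N → ℝ := fun j => if (j : ℕ) % 2 = 0 then σ⁻¹ else τ⁻¹ with hy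
  have hinner : ∀ j : Fin N, ∑ k : Fin N, (if (j : ℕ) % 2 ≠ (k : ℕ) % 2 then y k else 0) =
      if (j : ℕ) % 2 = 0 then t * τ⁻¹ else s * σ⁻¹ := by
    intro j
    split_ifs with hj
    · have : ∀ k : Fin N, (if (j : ℕ) % 2 ≠ (k : ℕ) % 2 then y k else 0) =
          if ¬((k : ℕ) % 2 = 0) then τ⁻¹ else 0 := by
        intro k
        simp only [hy]
        split_ifs <;> first | rfl | omega
      rw [Finset.sum_congr rfl fun k _ => this k, ← Finset.sum_filter, Finset.sum_const,
        card_odd_fin, nsmul_eq_mul]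
    · have : ∀ k : Fin N, (if (j : ℕ) % 2 ≠ (k : ℕ) % 2 then y k else 0) =
          if (k : ℕ) % 2 = 0 then σ⁻¹ else 0 := by
        intro k
        simp only [hy]
        split_ifs <;> first | rfl | omega
      rw [Finset.sum_congr rfl fun k _ => this k, ← Finset.sum_filter, Finset.sum_const,
        card_even_fin, nsmul_eq_mul]
  refine le_cliqueSpectralRadius_of_eigenvector _ (Sum.elim (fun _ => 1) y) ?_ ?_
  · intro h
    simpa using congrFun h (Sum.inl 0)
  · rintro (i | i)
    · have h1 : ∀ j k : Fin N, triangleIndicator (join (K 1) (SimpleGraph.turanGraph N 2))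
          (Sum.inl i) (Sum.inr j) (Sum.inr k) * (y j * y k) =
          y j * (if (j : ℕ) % 2 ≠ (k : ℕ) % 2 then y k else 0) := by
        intro j k
        simp only [triangleIndicator, join_adj_inl_inr, join_adj_inr, SimpleGraph.turanGraph_adj,
          true_and]
        split_ifs <;> ring
      obtain rfl : i = 0 := Subsingleton.elim _ _
      have h2 : ∀ j, triangleIndicator (join (K 1) (SimpleGraph.turanGraph N 2))
          (Sum.inl 0) (Sum.inl 0) j = 0 := fun j => triangleIndicator_of_not _ (by simp)
      have h3 : ∀ j, triangleIndicator (join (K 1) (SimpleGraph.turanGraph N 2))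
          (Sum.inl 0) j (Sum.inl 0) = 0 := fun j => triangleIndicator_of_not _ (by simp)
      simp only [Fintype.sum_sum_type, Finset.univ_unique, Finset.sum_singleton, Fin.default_eq_zero,
        h2, h3, zero_mul, Finset.sum_const_zero, zero_add, Sum.elim_inr, Sum.elim_inl, h1,
        ← Finset.mul_sum, hinner]
      have h4 : ∀ j : Fin N, y j * (if (j : ℕ) % 2 = 0 then t * τ⁻¹ else s * σ⁻¹) =
          if (j : ℕ) % 2 = 0 then σ⁻¹ * (t * τ⁻¹) else τ⁻¹ * (s * σ⁻¹) := by
        intro j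
        simp only [hy]
        split_ifs <;> rfl
      rw [Finset.sum_congr rfl fun j _ => h4 j, Finset.sum_ite, Finset.sum_const, Finset.sum_const,
        card_even_fin, card_odd_fin, nsmul_eq_mul, nsmul_eq_mul, ← hs, ← ht, ← hσs, ← hτt, hστ]
      field_simp
      ring
    · have h1 : ∀ j k : Fin N, triangleIndicator (join (K 1) (SimpleGraph.turanGraph N 2))
          (Sum.inr i) (Sum.inr j) (Sum.inr k) = 0 := by
        intro j k
        refine triangleIndicator_of_not _ ?_
        simp only [join_adj_inr, SimpleGraph.turanGraph_adj]
        omega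
      have h2 : ∀ k : Fin N, triangleIndicator (join (K 1) (SimpleGraph.turanGraph N 2))
          (Sum.inr i) (Sum.inl 0) (Sum.inr k) * y k =
          if (i : ℕ) % 2 ≠ (k : ℕ) % 2 then y k else 0 := by
        intro k
        simp only [triangleIndicator, join_adj_inl_inr, join_adj_inr_inl, join_adj_inr,
          SimpleGraph.turanGraph_adj, true_and, and_true]
        split_ifs <;> ring
      have h3 : ∀ k : Fin N, triangleIndicator (join (K 1) (SimpleGraph.turanGraph N 2))
          (Sum.inr i) (Sum.inr k) (Sum.inl 0) * y k =
          if (i : ℕ) % 2 ≠ (k : ℕ) % 2 then y k else 0 := by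
        intro k
        rw [triangleIndicator_swap_right, h2]
      have h4 : triangleIndicator (join (K 1) (SimpleGraph.turanGraph N 2))
          (Sum.inr i) (Sum.inl 0) (Sum.inl 0) = 0 := triangleIndicator_of_not _ (by simp)
      simp only [Fintype.sum_sum_type, Finset.univ_unique, Finset.sum_singleton, Fin.default_eq_zero,
        Sum.elim_inr, Sum.elim_inl, h1, h4, zero_mul, Finset.sum_const_zero, zero_add, add_zero,
        one_mul, mul_one, h2, h3, hinner]
      simp only [hy]
      rw [hστ, ← hσs, ← hτt]
      split_ifs <;> field_simp <;> ring

end Join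

/-! ### Values for complete graphs and graphs with a `K₅`; recognizing the models. -/

section Bounds

variable {V : Type*} [Fintype V] {G : SimpleGraph V}

theorem sum_cubes_pos {z : V → ℝ} (hz : ∀ i, 0 ≤ z i) (hz0 : z ≠ 0) : 0 < ∑ i, z i ^ 3 := by
  obtain ⟨i, hi⟩ := Function.ne_iff.1 hz0
  exact Finset.sum_pos' (fun i _ => pow_nonneg (hz i) 3)
    ⟨i, Finset.mem_univ i, pow_pos ((hz i).lt_of_ne' hi) 3⟩

theorem cliqueSpectralRadius_le_of_card (h3 : 3 ≤ Fintype.card V) :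
    2 * cliqueSpectralRadius 3 G ≤ ((Fintype.card V : ℝ) - 1) * (Fintype.card V - 2) ∧
      (2 * cliqueSpectralRadius 3 G = ((Fintype.card V : ℝ) - 1) * (Fintype.card V - 2) →
        G = ⊤) := by
  classical
  have : Nonempty V := Fintype.card_pos_iff.1 (by omega)
  obtain ⟨z, hz, hz0, hle⟩ := exists_cliqueSpectralRadius_mul_le_triangleForm G
  have hpos := sum_cubes_pos hz hz0
  have hc := complete_form_le G Finset.univ (by rwa [Finset.card_univ]) z hz
  rw [Finset.card_univ] at hc
  refine ⟨le_of_mul_le_mul_right (hle.trans hc.1) hpos, fun heq => ?_⟩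
  have h := hc.2 (by rw [← heq]; exact hle)
  obtain ⟨i₀, hi₀⟩ := Function.ne_iff.1 hz0
  have hall : ∀ i, 0 < z i := by
    intro i
    have h0 : 0 < z i₀ := (hz i₀).lt_of_ne' hi₀
    by_cases hi : i = i₀
    · rwa [hi]
    · rwa [(h i (Finset.mem_univ _) i₀ (Finset.mem_univ _) hi).1]
  ext i j
  rw [SimpleGraph.top_adj]
  exact ⟨fun h => h.ne, fun hij => (h i (Finset.mem_univ _) j (Finset.mem_univ _) hij).2 (hall i)⟩

theorem le_cliqueSpectralRadius_K (n : ℕ) (h2 : 2 ≤ n) :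
    ((n : ℝ) - 1) * (n - 2) ≤ 2 * cliqueSpectralRadius 3 (K n) := by
  have h := le_cliqueSpectralRadius_of_eigenvector (K n) (c := ((n : ℝ) - 1) * (n - 2) / 2)
    (fun _ => 1) (fun h => by simpa using congrFun h ⟨0, by omega⟩) (fun i => by
      have h1 := sum_sum_triangleIndicator_top (Finset.univ : Finset (Fin n)) (by simpa)
        (Finset.mem_univ i)
      rw [Finset.card_univ, Fintype.card_fin] at h1
      simp only [mul_one, h1]
      ring)
  linarith

/-- All triangles lie in the clique, so the form is that of `K₅`, and the indicator vector of `s` is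
an eigenvector; `6 = 4 * 3 / 2`. -/
theorem cliqueSpectralRadius_eq_six (hG : TrianglesIntersect G) {s : Finset V}
    (hs : G.IsNClique 5 s) : cliqueSpectralRadius 3 G = 6 := by
  classical
  have hmem : ∀ {i j k}, triangleIndicator G i j k ≠ 0 → i ∈ s ∧ j ∈ s ∧ k ∈ s := fun h =>
    hG.mem_of_isNClique_five hs (triangle_of_triangleIndicator_ne_zero G h)
  obtain ⟨a, ha⟩ : s.Nonempty := Finset.card_pos.1 (by rw [hs.card_eq]; norm_num)
  have : Nonempty V := ⟨a⟩
  refine le_antisymm ?_ ?_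
  · obtain ⟨z, hz, hz0, hle⟩ := exists_cliqueSpectralRadius_mul_le_triangleForm G
    have hpos := sum_cubes_pos hz hz0
    have hc := (complete_form_le G s (by rw [hs.card_eq]; norm_num) z hz).1
    have hQ : triangleForm G z =
        ∑ i ∈ s, ∑ j ∈ s, ∑ k ∈ s, triangleIndicator G i j k * (z i * z j * z k) := by
      have h0 : ∀ i j k, ¬(i ∈ s ∧ j ∈ s ∧ k ∈ s) →
          triangleIndicator G i j k * (z i * z j * z k) = 0 := fun i j k h => by
        rw [not_not.1 (mt hmem h), zero_mul]
      unfold triangleForm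
      symm
      refine (Finset.sum_congr rfl fun i _ => ?_).trans
        (Finset.sum_subset s.subset_univ fun i _ hi => ?_)
      · refine (Finset.sum_congr rfl fun j _ => ?_).trans
          (Finset.sum_subset s.subset_univ fun j _ hj => ?_)
        · exact Finset.sum_subset s.subset_univ fun k _ hk => h0 i j k (by tauto)
        · exact Finset.sum_eq_zero fun k _ => h0 i j k (by tauto)
      · exact Finset.sum_eq_zero fun j _ => Finset.sum_eq_zero fun k _ => h0 i j k (by tauto)
    rw [hs.card_eq] at hc
    have h1 : ∑ i ∈ s, z i ^ 3 ≤ ∑ i, z i ^ 3 :=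
      Finset.sum_le_sum_of_subset_of_nonneg s.subset_univ fun i _ _ => pow_nonneg (hz i) 3
    norm_num at hc
    by_contra! hlt
    nlinarith [mul_lt_mul_of_pos_right hlt hpos]
  · refine le_cliqueSpectralRadius_of_eigenvector G (fun i => if i ∈ s then 1 else 0) ?_ ?_
    · intro h
      simpa [ha] using congrFun h a
    · intro i
      split_ifs with hi
      · have h1 := sum_sum_triangleIndicator_top s (by rw [hs.card_eq]; norm_num) hi
        rw [hs.card_eq] at h1
        have h2 : ∀ j k, triangleIndicator G i j k *
            ((if j ∈ s then (1 : ℝ) else 0) * (if k ∈ s then 1 else 0)) =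
            if j ∈ s then (if k ∈ s then triangleIndicator (⊤ : SimpleGraph V) i j k else 0)
            else 0 := by
          intro j k
          by_cases hj : j ∈ s <;> by_cases hk : k ∈ s <;> simp only [hj, hk, if_true, if_false,
            mul_zero, mul_one]
          by_cases h : triangleIndicator (⊤ : SimpleGraph V) i j k = 0
          · rw [h]
            refine triangleIndicator_of_not G fun h' => ?_
            rw [triangleIndicator_of_triangle (⊤ : SimpleGraph V)
              (by simp [h'.1.ne, h'.2.1.ne, h'.2.2.ne])] at h
            exact one_ne_zero h
          · have h' := triangle_of_triangleIndicator_ne_zero _ h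
            simp only [SimpleGraph.top_adj] at h'
            rw [triangleIndicator_of_triangle (⊤ : SimpleGraph V) (by simpa using h'),
              triangleIndicator_of_triangle G ⟨hs.isClique hi hj h'.1, hs.isClique hi hk h'.2.1,
                hs.isClique hj hk h'.2.2⟩]
        have h3 : ∑ j, ∑ k, triangleIndicator G i j k *
            ((if j ∈ s then (1 : ℝ) else 0) * (if k ∈ s then 1 else 0)) =
            ∑ j ∈ s, ∑ k ∈ s, triangleIndicator (⊤ : SimpleGraph V) i j k := by
          rw [← Finset.sum_subset s.subset_univ]
          · refine Finset.sum_congr rfl fun j hj => ?_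
            rw [← Finset.sum_subset s.subset_univ]
            · exact Finset.sum_congr rfl fun k hk => by rw [h2, if_pos hj, if_pos hk]
            · intro k _ hk
              rw [h2, if_pos hj, if_neg hk]
          · intro j _ hj
            exact Finset.sum_eq_zero fun k _ => by rw [h2, if_neg hj]
        rw [h3, h1]
        norm_num
      · rw [Finset.sum_eq_zero]
        · norm_num
        · exact fun j _ => Finset.sum_eq_zero fun k _ => by
            rw [not_not.1 (mt hmem fun h => hi h.1), zero_mul]

theorem nonempty_iso_core [DecidableEq V] {C : Finset V} (hC : C.card = 3)
    (h : ∀ u v, G.Adj u v ↔ u ≠ v ∧ (u ∈ C ∨ v ∈ C)) :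
    Nonempty (G ≃g join (K 3) (isolated (Fintype.card V - 3))) := by
  refine nonempty_iso_of_coloring (fun v => decide (v ∈ C)) Sum.isLeft
    (fun p q => p = true ∨ q = true) (fun u v => by rw [h]; simp) ?_ ?_
  · rintro (u | u) (v | v)
    · simp [join_adj_inl]
    · simp [join_adj_inl_inr]
    · simp [join_adj_inr_inl]
    · simp [join_adj_inr]
  · rintro (_ | _)
    · have h1 : Fintype.card {v // decide (v ∈ C) = false} = Fintype.card V - 3 := by
        rw [Fintype.card_subtype, ← hC, ← Finset.card_compl]
        congr 1
        ext v
        simp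
      rw [h1, Fintype.card_subtype, Finset.card_filter, Fintype.sum_sum_type]
      simp
    · have h1 : Fintype.card {v // decide (v ∈ C) = true} = 3 := by
        rw [Fintype.card_subtype, ← hC]
        congr 1
        ext v
        simp
      rw [h1, Fintype.card_subtype, Finset.card_filter, Fintype.sum_sum_type]
      simp

/-- Both graphs are complete tripartite, with one part a single vertex: adjacency means different
colours. -/
theorem nonempty_iso_join_turanGraph [DecidableEq V] {N : ℕ} {v : V} {S T : Finset V}
    (hST : Disjoint S T) (hU : S ∪ T = Finset.univ.erase v)
    (hS : S.card = (N + 1) / 2) (hT : T.card = N / 2)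
    (hne : ∀ i j, G.Adj i j → ¬(i ∈ S ∧ j ∈ S) ∧ ¬(i ∈ T ∧ j ∈ T))
    (h : ∀ i ∈ S, ∀ j ∈ T, G.Adj i j) (hv : ∀ i, i ≠ v → G.Adj v i) :
    Nonempty (G ≃g join (K 1) (SimpleGraph.turanGraph N 2)) := by
  have hmem : ∀ u, (u ∈ S ∨ u ∈ T) ↔ u ≠ v := fun u => by
    rw [← Finset.mem_union, hU]
    simp
  have hdis : ∀ u, u ∈ S → u ∉ T := fun u h1 h2 => Finset.disjoint_left.1 hST h1 h2
  refine nonempty_iso_of_coloring (ι := Fin 3)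
    (fun u => if u = v then 0 else if u ∈ S then 1 else 2)
    (Sum.elim (fun _ => 0) (fun j => if (j : ℕ) % 2 = 0 then 1 else 2)) (· ≠ ·) ?_ ?_ ?_
  · intro i j
    by_cases hi : i = v
    · subst hi
      by_cases hj : j = i
      · simp [hj]
      · have := hv j hj
        by_cases hjS : j ∈ S <;> simp [hj, Ne.symm hj, this, hjS]
    by_cases hj : j = v
    · subst hj
      have := (hv i hi).symm
      by_cases hiS : i ∈ S <;> simp [hi, this, hiS]
    have hi' := (hmem i).2 hi
    have hj' := (hmem j).2 hj
    by_cases hiS : i ∈ S <;> by_cases hjS : j ∈ S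
    · simp only [hi, hj, hiS, hjS, if_true, if_false, ne_eq, not_true, and_false, iff_false]
      exact fun h' => (hne i j h').1 ⟨hiS, hjS⟩
    · have h1 := h i hiS j (by tauto)
      simp [hi, hj, hiS, hjS, h1, h1.ne]
    · have h1 := (h j hjS i (by tauto)).symm
      simp [hi, hj, hiS, hjS, h1, h1.ne]
    · simp only [hi, hj, hiS, hjS, if_false, ne_eq, not_true, and_false, iff_false]
      exact fun h' => (hne i j h').2 ⟨by tauto, by tauto⟩
  · rintro (u | u) (w | w)
    · simp [Subsingleton.elim u w]
    · simp only [join_adj_inl_inr, Sum.elim_inl, Sum.elim_inr, true_iff]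
      refine ⟨by simp, ?_⟩
      split_ifs <;> decide
    · simp only [join_adj_inr_inl, Sum.elim_inl, Sum.elim_inr, true_iff]
      refine ⟨by simp, ?_⟩
      split_ifs <;> decide
    · simp only [join_adj_inr, SimpleGraph.turanGraph_adj, Sum.elim_inr, ne_eq, Sum.inr.injEq]
      by_cases hu : (u : ℕ) % 2 = 0 <;> by_cases hw : (w : ℕ) % 2 = 0
      · simp [hu, hw]
      · simp only [hu, hw, if_true, if_false]
        refine ⟨fun _ => ⟨fun h => hw (h ▸ hu), by decide⟩, fun _ => by omega⟩
      · simp only [hu, hw, if_true, if_false]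
        refine ⟨fun _ => ⟨fun h => hu (h ▸ hw), by decide⟩, fun _ => by simp⟩
      · simp [hu, hw]
        omega
  · have e0 : ∀ u : V, (if u = v then (0 : Fin 3) else if u ∈ S then 1 else 2) = 0 ↔ u = v := by
      intro u
      split_ifs <;> simp_all
    have e1 : ∀ u : V, (if u = v then (0 : Fin 3) else if u ∈ S then 1 else 2) = 1 ↔ u ∈ S := by
      intro u
      have := hmem u
      grind
    have e2 : ∀ u : V, (if u = v then (0 : Fin 3) else if u ∈ S then 1 else 2) = 2 ↔ u ∈ T := by
      intro u
      have := hmem u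
      have := hdis u
      grind
    intro c
    rw [Fintype.card_subtype, Fintype.card_subtype]
    conv_rhs => rw [Finset.card_filter, Fintype.sum_sum_type]
    have key : ∀ j : Fin N, ((if (j : ℕ) % 2 = 0 then (1 : Fin 3) else 2) = 0 ↔ False) ∧
        ((if (j : ℕ) % 2 = 0 then (1 : Fin 3) else 2) = 1 ↔ (j : ℕ) % 2 = 0) ∧
        ((if (j : ℕ) % 2 = 0 then (1 : Fin 3) else 2) = 2 ↔ ¬((j : ℕ) % 2 = 0)) := by
      intro j
      split_ifs <;> simp_all
    have hE : ∑ j : Fin N, (if (j : ℕ) % 2 = 0 then 1 else 0) = (N + 1) / 2 := by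
      rw [← card_even_fin N, Finset.card_filter]
    have hO : ∑ j : Fin N, (if ¬((j : ℕ) % 2 = 0) then 1 else 0) = N / 2 := by
      rw [← card_odd_fin N, Finset.card_filter]
    fin_cases c
    · simp only [Fin.zero_eta, e0, Sum.elim_inl, Sum.elim_inr, key]
      simp
      exact Finset.card_eq_one.2 ⟨v, by ext; simp⟩
    · simp only [Fin.mk_one, e1, Sum.elim_inl, Sum.elim_inr, key, hE,
        Finset.filter_mem_eq_inter, Finset.univ_inter, hS]
      simp
    · simp only [Fin.reduceFinMk, e2, Sum.elim_inl, Sum.elim_inr, key, hO,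
        Finset.filter_mem_eq_inter, Finset.univ_inter, hT]
      simp

end Bounds

/-! ### Spectral bounds by type of triangle cover. -/

section UpperBounds

variable {V : Type*} [Fintype V] {G : SimpleGraph V}

/-- The bound for graphs all of whose triangles share a vertex. -/
theorem cliqueSpectralRadius_le_of_vertex_cover {N : ℕ} (hV : Fintype.card V = N + 1) (hN : 2 ≤ N)
    {v : V} (hv : ∀ i j k, G.Adj i j ∧ G.Adj i k ∧ G.Adj j k → v = i ∨ v = j ∨ v = k)
    {κ : ℝ} (hκ : 0 < κ) (hκN : κ ^ 3 = ((N + 1) / 2 * (N / 2) : ℕ)) :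
    cliqueSpectralRadius 3 G ≤ κ ^ 2 ∧ (cliqueSpectralRadius 3 G = κ ^ 2 →
      Nonempty (G ≃g join (K 1) (SimpleGraph.turanGraph N 2))) := by
  classical
  have : Nonempty V := ⟨v⟩
  obtain ⟨z, hz, hz0, hle⟩ := exists_cliqueSpectralRadius_mul_le_triangleForm G
  have hpos := sum_cubes_pos hz hz0
  obtain ⟨S, T, hST, hU, hQ, heqQ⟩ := exists_bipartition_triangleForm_le G v hv z hz
  have hcard : S.card + T.card = N := by
    rw [← Finset.card_union_of_disjoint hST, hU, Finset.card_erase_of_mem (Finset.mem_univ v),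
      Finset.card_univ, hV]
    omega
  have hmem : ∀ i, i ≠ v → i ∈ S ∨ i ∈ T := fun i hi => by
    rw [← Finset.mem_union, hU]
    simp [hi]
  have hsum : ∑ i, z i ^ 3 = z v ^ 3 + ∑ i ∈ S, z i ^ 3 + ∑ i ∈ T, z i ^ 3 := by
    rw [add_assoc, ← Finset.sum_union hST, hU]
    exact (Finset.add_sum_erase _ _ (Finset.mem_univ v)).symm
  by_cases hne : S.card = 0 ∨ T.card = 0
  · have h0 : (∑ i ∈ S, z i) * ∑ j ∈ T, z j = 0 := by
      rcases hne with h | h <;> rw [Finset.card_eq_zero.1 h] <;> simp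
    rw [h0, mul_zero] at hQ
    have h1 : cliqueSpectralRadius 3 G ≤ 0 := by
      by_contra! h
      have := mul_pos h hpos
      linarith
    have h2 : 0 < κ ^ 2 := by positivity
    exact ⟨by linarith, fun h => by linarith⟩
  push Not at hne
  obtain ⟨σ, hσ, hσS⟩ := exists_cube_root (a := (S.card : ℝ)) (by
    exact_mod_cast Nat.pos_of_ne_zero hne.1)
  obtain ⟨τ, hτ, hτT⟩ := exists_cube_root (a := (T.card : ℝ)) (by
    exact_mod_cast Nat.pos_of_ne_zero hne.2)
  have hprod : S.card * T.card ≤ (N + 1) / 2 * (N / 2) ∧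
      ((N + 1) / 2 * (N / 2) ≤ S.card * T.card → S.card = (N + 1) / 2 ∧ T.card = N / 2 ∨
        T.card = (N + 1) / 2 ∧ S.card = N / 2) := by
    obtain ⟨s, hs⟩ : ∃ s, s = S.card := ⟨_, rfl⟩
    obtain ⟨t, ht⟩ : ∃ t, t = T.card := ⟨_, rfl⟩
    obtain ⟨p, hp⟩ : ∃ p, p = N / 2 := ⟨_, rfl⟩
    obtain ⟨q, hq⟩ : ∃ q, q = (N + 1) / 2 := ⟨_, rfl⟩
    rw [← hs, ← ht] at hcard ⊢
    rw [← hp, ← hq]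
    have hpq : p + q = s + t := by omega
    have hpq' : q = p ∨ q = p + 1 := by omega
    -- With `p = s + d` and `t = q + d`, the deficit `q * p - s * t` is `d * (q - s)`, at least `d ^
    -- 2` because `p ≤ q`.
    have key : ∀ s t : ℕ, p + q = s + t → s ≤ p →
        s * t ≤ q * p ∧ (q * p ≤ s * t → s = p ∧ t = q) := by
      intro s t h hs
      obtain ⟨d, rfl⟩ := Nat.exists_eq_add_of_le hs
      obtain rfl : t = q + d := by omega
      have hq : s + d ≤ q := by omega
      constructor
      · nlinarith
      · intro hle
        obtain rfl : d = 0 := by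
          by_contra hd
          have : 0 < d := Nat.pos_of_ne_zero hd
          nlinarith
        simp
    rcases (by omega : s ≤ p ∨ t ≤ p) with h | h
    · have := key s t hpq h
      exact ⟨this.1, fun h => Or.inr (this.2 h).symm⟩
    · have := key t s (by omega) h
      rw [mul_comm s t]
      exact ⟨this.1, fun h => Or.inl (this.2 h).symm⟩
  have hστ : σ * τ ≤ κ := by
    refine le_of_pow_le_pow_left₀ (by norm_num : (3 : ℕ) ≠ 0) hκ.le ?_
    rw [mul_pow, hσS, hτT, hκN]
    exact_mod_cast hprod.1
  have hform := bipartite_form_le (z v) (hz v) z hz S T hσ hτ hσS hτT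
  rw [← hsum] at hform
  have h1 : cliqueSpectralRadius 3 G ≤ (σ * τ) ^ 2 := by
    refine le_of_mul_le_mul_right ?_ hpos
    linarith [hform.1]
  have h2 : (σ * τ) ^ 2 ≤ κ ^ 2 := pow_le_pow_left₀ (by positivity) hστ 2
  refine ⟨h1.trans h2, fun heq => ?_⟩
  have h3 : κ = σ * τ := by
    refine le_antisymm (le_of_pow_le_pow_left₀ (by norm_num : (2 : ℕ) ≠ 0) (by positivity) ?_) hστ
    rw [← heq]
    exact h1
  have h4 := hform.2 (by rw [← h3, ← heq]; linarith)
  obtain ⟨i₀, hi₀⟩ := Finset.card_pos.1 (Nat.pos_of_ne_zero hne.1)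
  obtain ⟨j₀, hj₀⟩ := Finset.card_pos.1 (Nat.pos_of_ne_zero hne.2)
  have hvpos : 0 < z v := by
    refine (hz v).lt_of_ne fun h0 => hz0 (funext fun i => ?_)
    by_cases hi : i = v
    · rw [hi, ← h0]; rfl
    rcases hmem i hi with hi | hi
    · have := (h4 i hi j₀ hj₀).1
      rw [← h0] at this
      exact (mul_eq_zero.1 this.symm).resolve_left hσ.ne'
    · have := (h4 i₀ hi₀ i hi).1.trans (h4 i₀ hi₀ i hi).2
      rw [← h0] at this
      exact (mul_eq_zero.1 this.symm).resolve_left hτ.ne'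
  have hall : ∀ i, 0 < z i := by
    intro i
    by_cases hi : i = v
    · rwa [hi]
    rcases hmem i hi with hi | hi
    · have := (h4 i hi j₀ hj₀).1
      exact pos_of_mul_pos_right (this ▸ hvpos) hσ.le
    · have := (h4 i₀ hi₀ i hi).1.trans (h4 i₀ hi₀ i hi).2
      exact pos_of_mul_pos_right (this ▸ hvpos) hτ.le
  have hadj := heqQ hall (by
    have h5 := hform.1
    rw [← h3, ← heq] at h5
    linarith)
  have hvadj : ∀ i, i ≠ v → G.Adj v i := by
    intro i hi
    rcases hmem i hi with hi | hi
    · exact (hadj i hi j₀ hj₀).1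
    · exact (hadj i₀ hi₀ i hi).2.1
  have hvS : v ∉ S ∧ v ∉ T := by
    rw [← not_or, ← Finset.mem_union, hU]
    simp
  -- An edge inside one part and a vertex of the other would span a triangle avoiding `v`.
  have hno : ∀ i j, G.Adj i j → ¬(i ∈ S ∧ j ∈ S) ∧ ¬(i ∈ T ∧ j ∈ T) := by
    intro i j hij
    constructor
    · rintro ⟨hi, hj⟩
      rcases hv i j j₀ ⟨hij, (hadj i hi j₀ hj₀).2.2, (hadj j hj j₀ hj₀).2.2⟩ with rfl | rfl | rfl
      exacts [hvS.1 hi, hvS.1 hj, hvS.2 hj₀]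
    · rintro ⟨hi, hj⟩
      rcases hv i j i₀ ⟨hij, (hadj i₀ hi₀ i hi).2.2.symm, (hadj i₀ hi₀ j hj).2.2.symm⟩ with
        rfl | rfl | rfl
      exacts [hvS.2 hi, hvS.2 hj, hvS.1 hi₀]
  rcases hprod.2 (by
    have : ((N + 1) / 2 * (N / 2) : ℕ) = ((S.card * T.card : ℕ) : ℝ) := by
      rw [← hκN, h3, mul_pow, hσS, hτT]; push_cast; rfl
    exact_mod_cast this.le) with ⟨hS, hT⟩ | ⟨hT, hS⟩
  · exact nonempty_iso_join_turanGraph hST hU hS hT hno (fun i hi j hj => (hadj i hi j hj).2.2)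
      hvadj
  · exact nonempty_iso_join_turanGraph hST.symm (by rw [Finset.union_comm, hU]) hT hS
      (fun i j h => (hno i j h).symm) (fun i hi j hj => (hadj j hj i hi).2.2.symm) hvadj

/-- The bound for graphs whose triangles are covered by two vertices but not by one. -/
theorem cliqueSpectralRadius_le_of_pair_cover {m : ℕ} (hV : Fintype.card V = m + 3) (hm : 3 ≤ m)
    (hint : TrianglesIntersect G) {a b : V} (hab : a ≠ b)
    (hcov : ∀ i j k, G.Adj i j ∧ G.Adj i k ∧ G.Adj j k →
      a = i ∨ a = j ∨ a = k ∨ b = i ∨ b = j ∨ b = k)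
    (ha : ∃ i j k, (G.Adj i j ∧ G.Adj i k ∧ G.Adj j k) ∧ a ≠ i ∧ a ≠ j ∧ a ≠ k)
    (hb : ∃ i j k, (G.Adj i j ∧ G.Adj i k ∧ G.Adj j k) ∧ b ≠ i ∧ b ≠ j ∧ b ≠ k)
    {r : ℝ} (hr : 0 < r) (hrs : r ^ 2 + 2 * m * r ^ 3 = 3) :
    cliqueSpectralRadius 3 G ≤ 1 + 2 * m * r ∧ (cliqueSpectralRadius 3 G = 1 + 2 * m * r →
      Nonempty (G ≃g join (K 3) (isolated m))) := by
  classical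
  have : Nonempty V := ⟨a⟩
  obtain ⟨z, hz, hz0, hle⟩ := exists_cliqueSpectralRadius_mul_le_triangleForm G
  have hpos := sum_cubes_pos hz hz0
  obtain ⟨c, hca, hcb, hQ, heqQ⟩ := exists_triangleForm_le_core G a b hab hcov ha hb hint z hz
  set s := ((Finset.univ.erase a).erase b).erase c with hs
  have hb1 : b ∈ Finset.univ.erase a := by simp [hab.symm]
  have hc1 : c ∈ (Finset.univ.erase a).erase b := by simp [hca, hcb]
  have hmem : ∀ w, w ∈ s ↔ w ≠ c ∧ w ≠ b ∧ w ≠ a := fun w => by simp [hs]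
  have hcard : s.card = m := by
    rw [hs, Finset.card_erase_of_mem hc1, Finset.card_erase_of_mem hb1,
      Finset.card_erase_of_mem (Finset.mem_univ a), Finset.card_univ, hV]
    omega
  have hsum : ∑ i, z i ^ 3 = z a ^ 3 + z b ^ 3 + z c ^ 3 + ∑ w ∈ s, z w ^ 3 := by
    rw [← Finset.add_sum_erase _ _ (Finset.mem_univ a), ← Finset.add_sum_erase _ _ hb1,
      ← Finset.add_sum_erase _ _ hc1]
    ring
  have hform := core_form_le (hz a) (hz b) (hz c) z hz s hr (by rw [hcard]; exact hrs)
  rw [hcard, ← hsum] at hform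
  have h1 : cliqueSpectralRadius 3 G ≤ 1 + 2 * m * r := by
    refine le_of_mul_le_mul_right ?_ hpos
    linarith [hform.1]
  refine ⟨h1, fun heq => ?_⟩
  rw [heq] at hle
  obtain ⟨eab, ebc, ew⟩ := hform.2 (by linarith)
  have hr1 : r < 1 := by
    by_contra! h
    have hm' : (3 : ℝ) ≤ m := by exact_mod_cast hm
    have h2 : 1 ≤ r ^ 2 := one_le_pow₀ h
    have h3 : 1 ≤ r ^ 3 := one_le_pow₀ h
    nlinarith
  have hapos : 0 < z a := by
    refine (hz a).lt_of_ne fun h0 => hz0 (funext fun w => ?_)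
    by_cases hw : w ∈ s
    · rw [ew w hw, ← h0, mul_zero]; rfl
    · rw [hmem] at hw
      have : w = a ∨ w = b ∨ w = c := by tauto
      rcases this with rfl | rfl | rfl
      · exact h0.symm
      · rw [← eab, ← h0]; rfl
      · rw [← ebc, ← eab, ← h0]; rfl
  have hall : ∀ w, 0 < z w := by
    intro w
    by_cases hw : w ∈ s
    · rw [ew w hw]; positivity
    · rw [hmem] at hw
      have : w = a ∨ w = b ∨ w = c := by tauto
      rcases this with rfl | rfl | rfl
      · exact hapos
      · rwa [← eab]
      · rwa [← ebc, ← eab]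
  have hadj := heqQ hall (fun k hka hkb hkc => by
    rw [ew k ((hmem k).2 ⟨hkc, hkb, hka⟩), ← ebc, ← eab]
    nlinarith) (by omega) (by linarith [hform.1])
  have hC : ({a, b, c} : Finset V).card = 3 := Finset.card_eq_three.2
    ⟨a, b, c, hab, hca.symm, hcb.symm, rfl⟩
  have hm3 : Fintype.card V - 3 = m := by omega
  have hiso := nonempty_iso_core (G := G) hC (fun u v => ?_)
  · rwa [hm3] at hiso
  · constructor
    · intro huv
      refine ⟨huv.ne, ?_⟩
      by_contra! hn
      have hus : u ∈ s := by rw [hmem]; simp at hn; tauto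
      have hvs : v ∈ s := by rw [hmem]; simp at hn; tauto
      -- An extra edge `uv` would give the disjoint triangles `auv` and `bcw`; a third outer vertex
      -- `w` exists because `3 ≤ m`.
      obtain ⟨w, hw⟩ : ((s.erase u).erase v).Nonempty := by
        rw [← Finset.card_pos, Finset.card_erase_of_mem (Finset.mem_erase.2 ⟨huv.ne', hvs⟩),
          Finset.card_erase_of_mem hus]
        omega
      simp only [Finset.mem_erase] at hw
      have hws := (hmem w).1 hw.2.2
      have hus' := (hmem u).1 hus
      have hvs' := (hmem v).1 hvs
      have := hint a u v b c w
        ⟨hadj a (by simp) u hus'.2.2, hadj a (by simp) v hvs'.2.2, huv⟩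
        ⟨hadj b (by simp) c hcb, hadj b (by simp) w hws.2.1, hadj c (by simp) w hws.1⟩
      grind
    · rintro ⟨huv, h | h⟩
      · exact hadj u h v huv.symm
      · exact (hadj v h u huv).symm

/-- A graph whose triangles pairwise intersect either has all triangles through one vertex, or has
them covered by two vertices, or contains a `K₅`. -/
theorem TrianglesIntersect.cover_trichotomy [Nonempty V] (hG : TrianglesIntersect G) :
    (∃ v, ∀ i j k, G.Adj i j ∧ G.Adj i k ∧ G.Adj j k → v = i ∨ v = j ∨ v = k) ∨
    (∃ a b, a ≠ b ∧ (∀ i j k, G.Adj i j ∧ G.Adj i k ∧ G.Adj j k →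
        a = i ∨ a = j ∨ a = k ∨ b = i ∨ b = j ∨ b = k) ∧
      (∃ i j k, (G.Adj i j ∧ G.Adj i k ∧ G.Adj j k) ∧ a ≠ i ∧ a ≠ j ∧ a ≠ k) ∧
      ∃ i j k, (G.Adj i j ∧ G.Adj i k ∧ G.Adj j k) ∧ b ≠ i ∧ b ≠ j ∧ b ≠ k) ∨
    ∃ s : Finset V, G.IsNClique 5 s := by
  by_cases h1 : ∃ v, ∀ i j k, G.Adj i j ∧ G.Adj i k ∧ G.Adj j k → v = i ∨ v = j ∨ v = k
  · exact Or.inl h1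
  have h1' : ∀ v, ∃ i j k, (G.Adj i j ∧ G.Adj i k ∧ G.Adj j k) ∧ v ≠ i ∧ v ≠ j ∧ v ≠ k := by
    intro v
    by_contra h
    exact h1 ⟨v, fun i j k ht => by
      by_contra hc
      exact h ⟨i, j, k, ht, by tauto⟩⟩
  by_cases h2 : ∃ a b, ∀ i j k, G.Adj i j ∧ G.Adj i k ∧ G.Adj j k →
      a = i ∨ a = j ∨ a = k ∨ b = i ∨ b = j ∨ b = k
  · obtain ⟨a, b, hab⟩ := h2
    refine Or.inr (Or.inl ⟨a, b, ?_, hab, h1' a, h1' b⟩)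
    rintro rfl
    exact h1 ⟨a, fun i j k ht => by have := hab i j k ht; tauto⟩
  · refine Or.inr (Or.inr (hG.exists_isNClique_five fun a b => ?_))
    by_contra h
    exact h2 ⟨a, b, fun i j k ht => by
      by_contra hc
      exact h ⟨i, j, k, ht, by tauto⟩⟩

end UpperBounds

/-! ### Comparing the three candidate values. -/

section Numerics

theorem exists_core_root (m : ℕ) (hm : 1 ≤ m) : ∃ r : ℝ, 0 < r ∧ r ^ 2 + 2 * m * r ^ 3 = 3 := by
  have hm' : (1 : ℝ) ≤ m := by exact_mod_cast hm
  have hc : ContinuousOn (fun r : ℝ => r ^ 2 + 2 * m * r ^ 3) (Set.Icc 0 1) := by fun_prop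
  obtain ⟨r, hr, hr3⟩ := intermediate_value_Icc zero_le_one hc
    (show (3 : ℝ) ∈ Set.Icc _ _ by constructor <;> norm_num; linarith)
  refine ⟨r, hr.1.lt_of_ne ?_, hr3⟩
  rintro rfl
  norm_num at hr3

/-- Otherwise `r ≤ 5 / 8`, and `3 = r ^ 2 * (1 + 2mr) ≤ 6 * (5 / 8) ^ 2 < 3`. The case `m = 3` below
reverses the argument with `5 / 6`. -/
theorem six_lt_core {m : ℕ} (hm : 4 ≤ m) {r : ℝ} (hr : 0 < r)
    (hrs : r ^ 2 + 2 * m * r ^ 3 = 3) : 6 < 1 + 2 * m * r := by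
  have hm' : (4 : ℝ) ≤ m := by exact_mod_cast hm
  by_contra! h
  have h1 : r ≤ 5 / 8 := by nlinarith
  nlinarith [mul_le_mul_of_nonneg_right h (sq_nonneg r), mul_self_le_mul_self hr.le h1]

theorem core_three_lt_six {r : ℝ} (hrs : r ^ 2 + 2 * (3 : ℕ) * r ^ 3 = 3) :
    1 + 2 * (3 : ℕ) * r < 6 := by
  push_cast at *
  by_contra! h
  have h1 : 5 / 6 ≤ r := by linarith
  nlinarith [mul_self_le_mul_self (by norm_num) h1, sq_nonneg r]

/-- If it failed, multiplying by `r ^ 2` would give `κ * r ≥ √3`, and multiplying by `κ` eliminates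
`r`: `κ + 2√3 m ≤ κ ^ 3`. The tight case is `n = 13`, where 1.73 for `√3` and `κ ≥ 2` give `36.6 ≤
36`. -/
theorem vertex_bound_lt_core {n : ℕ} (h7 : 7 ≤ n) (h13 : n ≤ 13) {r κ : ℝ} (hr : 0 < r)
    (hrs : r ^ 2 + 2 * (n - 3 : ℕ) * r ^ 3 = 3) (hκ : 0 < κ)
    (hκN : κ ^ 3 = ((n - 1 + 1) / 2 * ((n - 1) / 2) : ℕ)) : κ ^ 2 < 1 + 2 * (n - 3 : ℕ) * r := by
  set m : ℝ := ((n - 3 : ℕ) : ℝ) with hm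
  by_contra! h
  have h1 : 3 ≤ (κ * r) ^ 2 := by nlinarith [mul_le_mul_of_nonneg_right h (sq_nonneg r)]
  have h2 : 1.73 ≤ κ * r := by nlinarith [mul_pos hκ hr]
  have h3 : κ + 2 * m * (κ * r) ≤ κ ^ 3 := by nlinarith
  have hm0 : 0 ≤ m := Nat.cast_nonneg _
  have h4 : κ + 2 * m * 1.73 ≤ κ ^ 3 := by nlinarith
  have h5 : 2 ≤ κ := by
    by_contra! hlt
    have h6 : κ ^ 3 < 2 ^ 3 := pow_lt_pow_left₀ hlt hκ.le (by norm_num)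
    rw [hκN] at h6
    interval_cases n <;> norm_num at h6
  rw [hκN] at h4
  interval_cases n <;> norm_num [hm] at h4 <;> linarith

theorem core_lt_vertex_bound {n : ℕ} (h14 : 14 ≤ n) {r κ : ℝ} (hr : 0 < r)
    (hrs : r ^ 2 + 2 * (n - 3 : ℕ) * r ^ 3 = 3) (hκ : 0 < κ)
    (hκN : κ ^ 3 = ((n - 1 + 1) / 2 * ((n - 1) / 2) : ℕ)) : 1 + 2 * (n - 3 : ℕ) * r < κ ^ 2 := by
  have hm : ((n - 3 : ℕ) : ℝ) = n - 3 := by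
    rw [Nat.cast_sub (by omega)]; norm_num
  rw [hm] at hrs ⊢
  have hn : (14 : ℝ) ≤ n := by exact_mod_cast h14
  set q : ℕ := (n - 1 + 1) / 2 * ((n - 1) / 2) with hq
  have hq1 : n * (n - 2) ≤ 4 * q := by
    rcases Nat.even_or_odd' n with ⟨k, rfl | rfl⟩
    · have e1 : (2 * k - 1 + 1) / 2 = k := by omega
      have e2 : (2 * k - 1) / 2 = k - 1 := by omega
      have e3 : 2 * k - 2 = 2 * (k - 1) := by omega
      rw [hq, e1, e2, e3]
      exact le_of_eq (by ring)
    · have e1 : (2 * k + 1 - 1 + 1) / 2 = k := by omega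
      have e2 : (2 * k + 1 - 1) / 2 = k := by omega
      obtain ⟨j, rfl⟩ : ∃ j, k = j + 1 := ⟨k - 1, by omega⟩
      have e3 : 2 * (j + 1) + 1 - 2 = 2 * j + 1 := by omega
      rw [hq, e1, e2, e3]
      nlinarith
  have hq2 : (n : ℝ) * (n - 2) ≤ 4 * q := by
    have : ((n * (n - 2) : ℕ) : ℝ) ≤ (4 * q : ℕ) := by exact_mod_cast hq1
    rw [Nat.cast_mul, Nat.cast_sub (by omega)] at this
    push_cast at this
    exact this
  have hq42 : (42 : ℝ) ≤ q := by nlinarith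
  by_contra! h
  have h1 : (κ * r) ^ 2 ≤ 3 := by nlinarith [mul_le_mul_of_nonneg_right h (sq_nonneg r)]
  have h2 : κ * r ≤ 1.73206 := by nlinarith [mul_pos hκ hr]
  have h3 : κ ^ 3 ≤ κ + 2 * (n - 3) * (κ * r) := by nlinarith
  have h4 : κ ^ 3 ≤ κ + 2 * (n - 3) * 1.73206 := by nlinarith
  -- `κ ^ 6 = q ^ 2 ≥ 42 ^ 2 = 1764 > 12 ^ 3`. Hence `κ ≤ q / 12`, which turns `h4` into an
  -- inequality linear in `q`; at `n = 14` it reads `38.5 ≤ 38.11`.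
  have h5 : 12 ≤ κ ^ 2 := by
    by_contra! hlt
    have h6 : (κ ^ 2) ^ 3 < 12 ^ 3 := pow_lt_pow_left₀ hlt (by positivity) (by norm_num)
    have h7 : (κ ^ 2) ^ 3 = q ^ 2 := by rw [← hκN]; ring
    nlinarith
  have h6 : 12 * κ ≤ q := by rw [← hκN]; nlinarith
  rw [hκN] at h4
  nlinarith

end Numerics

/-! ### Graphs on six vertices. -/

section Six

theorem trianglesIntersect_of_subset_card_le_five {V : Type*} {G : SimpleGraph V} (s : Finset V)
    (hs : s.card ≤ 5)
    (h : ∀ i j k, G.Adj i j ∧ G.Adj i k ∧ G.Adj j k → i ∈ s ∧ j ∈ s ∧ k ∈ s) :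
    TrianglesIntersect G := by
  classical
  intro i j k i' j' k' ht ht'
  by_contra hne
  push Not at hne
  have hsub : ({i, j, k, i', j', k'} : Finset V) ⊆ s := by
    have := h i j k ht
    have := h i' j' k' ht'
    intro a ha
    simp only [Finset.mem_insert, Finset.mem_singleton] at ha
    grind
  have hc := Finset.card_le_card hsub
  have := ht.1.ne
  have := ht.2.1.ne
  have := ht.2.2.ne
  have := ht'.1.ne
  have := ht'.2.1.ne
  have := ht'.2.2.ne
  rw [Finset.card_insert_of_notMem (by grind), Finset.card_insert_of_notMem (by grind),
    Finset.card_insert_of_notMem (by grind), Finset.card_insert_of_notMem (by grind),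
    Finset.card_insert_of_notMem (by grind), Finset.card_singleton] at hc
  omega

theorem trianglesIntersect_K {n : ℕ} (hn : n ≤ 5) : TrianglesIntersect (K n) :=
  trianglesIntersect_of_subset_card_le_five Finset.univ (by simpa) (by simp)

theorem isNClique_five_K5_sum : (K 5 ⊕g K 1).IsNClique 5
    ((Finset.univ : Finset (Fin 5)).map Function.Embedding.inl) := by
  refine ⟨?_, by simp⟩
  intro u hu v hv huv
  simp at hu hv
  obtain ⟨u, rfl⟩ := hu
  obtain ⟨v, rfl⟩ := hv
  simpa using huv

theorem isNClique_five_G₀ : G₀.IsNClique 5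
    ((Finset.univ : Finset (Fin 5)).map Function.Embedding.inl) :=
  isNClique_five_K5_sum.mono le_sup_left

theorem G₀_adj_inl_inl (u v : Fin 5) : G₀.Adj (.inl u) (.inl v) ↔ u ≠ v := by
  simp [G₀, SimpleGraph.edge_adj]

theorem G₀_adj_inl_inr (u : Fin 5) (v : Fin 1) : G₀.Adj (.inl u) (.inr v) ↔ u = 0 := by
  simp [G₀, SimpleGraph.edge_adj, Subsingleton.elim v 0]

theorem G₀_adj_inr_inl (u : Fin 5) (v : Fin 1) : G₀.Adj (.inr v) (.inl u) ↔ u = 0 := by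
  rw [SimpleGraph.adj_comm, G₀_adj_inl_inr]

theorem G₀_adj_inr_inr (u v : Fin 1) : ¬G₀.Adj (.inr u) (.inr v) := by
  rw [Subsingleton.elim u v]
  exact SimpleGraph.irrefl _

theorem trianglesIntersect_G₀ : TrianglesIntersect G₀ := by
  refine trianglesIntersect_of_subset_card_le_five
    ((Finset.univ : Finset (Fin 5)).map Function.Embedding.inl) (by simp) ?_
  rintro (i | i) (j | j) (k | k) h <;>
    simp only [G₀_adj_inl_inl, G₀_adj_inl_inr, G₀_adj_inr_inl, G₀_adj_inr_inr] at h <;>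
    simp <;> grind

theorem trianglesIntersect_K5_sum : TrianglesIntersect (K 5 ⊕g K 1) := by
  have hle : (K 5 ⊕g K 1) ≤ G₀ := le_sup_left
  exact fun i j k i' j' k' h h' => trianglesIntersect_G₀ i j k i' j' k'
    ⟨hle h.1, hle h.2.1, hle h.2.2⟩ ⟨hle h'.1, hle h'.2.1, hle h'.2.2⟩

/-- Two neighbours of the sixth vertex would span with it a triangle not inside the clique, so it
has at most one; none gives `K₅ ∪ K₁`, one gives `G₀`. -/
theorem nonempty_iso_of_isNClique_five {V : Type*} [Fintype V] {G : SimpleGraph V}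
    (hV : Fintype.card V = 6) (hG : TrianglesIntersect G) {s : Finset V} (hs : G.IsNClique 5 s) :
    Nonempty (G ≃g (K 5 ⊕g K 1)) ∨ Nonempty (G ≃g G₀) := by
  classical
  obtain ⟨w, hw⟩ := Finset.card_eq_one.1 (show sᶜ.card = 1 by
    rw [Finset.card_compl, hs.card_eq, hV])
  have hmem : ∀ v, v ∈ s ↔ v ≠ w := fun v => by
    rw [← not_iff_not, ← Finset.mem_compl, hw]
    simp
  have hadj : ∀ u v, u ≠ w → v ≠ w → u ≠ v → G.Adj u v := fun u v hu hv huv =>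
    hs.isClique ((hmem u).2 hu) ((hmem v).2 hv) huv
  have huniq : ∀ u v, G.Adj w u → G.Adj w v → u = v := by
    intro u v hu hv
    by_contra huv
    exact (hmem w).1 (hG.mem_of_isNClique_five hs
      ⟨hu, hv, hadj u v hu.ne' hv.ne' huv⟩).1 rfl
  by_cases h : ∃ a, G.Adj w a
  · obtain ⟨a, ha⟩ := h
    right
    have haw := ha.ne'
    have hwadj : ∀ u, G.Adj w u ↔ u = a := fun u =>
      ⟨fun h => huniq u a h ha, fun h => h ▸ ha⟩
    refine nonempty_iso_of_coloring (ι := Fin 3)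
      (fun v => if v = w then 2 else if v = a then 1 else 0)
      (Sum.elim (fun i => if i = 0 then 1 else 0) (fun _ => 2))
      (fun x y => (x ≠ 2 ∧ y ≠ 2) ∨ (x = 1 ∧ y = 2) ∨ (x = 2 ∧ y = 1)) ?_ ?_ ?_
    · intro u v
      by_cases hu : u = w
      · subst hu
        by_cases hv : v = a
        · subst hv
          simp [haw, haw.symm, ha]
        · have : ¬G.Adj u v := fun h => hv ((hwadj v).1 h)
          by_cases hvu : v = u <;> simp [hv, hvu, this]
      by_cases hv : v = w
      · subst hv
        by_cases hu' : u = a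
        · subst hu'
          simp [haw, ha.symm]
        · have : ¬G.Adj u v := fun h => hu' ((hwadj u).1 h.symm)
          simp [hu, hu', this]
      · have h1 : G.Adj u v ↔ u ≠ v := ⟨fun h => h.ne, hadj u v hu hv⟩
        rw [h1]
        by_cases hu' : u = a <;> by_cases hv' : v = a <;> simp [hu, hv, hu', hv', haw]
    · rintro (u | u) (v | v)
      · rw [G₀_adj_inl_inl]
        revert u v; decide
      · rw [G₀_adj_inl_inr]
        revert u v; decide
      · rw [G₀_adj_inr_inl]
        revert u v; decide
      · simp [Subsingleton.elim u v]
    · intro c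
      rw [Fintype.card_subtype]
      fin_cases c
      · have : (Finset.univ.filter fun v : V =>
            (if v = w then (2 : Fin 3) else if v = a then 1 else 0) = 0) =
            (Finset.univ.erase w).erase a := by
          ext v
          by_cases h1 : v = w <;> by_cases h2 : v = a <;> simp [h1, h2, haw]
        simp only [Fin.zero_eta, this]
        rw [Finset.card_erase_of_mem (by simp [haw]), Finset.card_erase_of_mem (Finset.mem_univ w),
          Finset.card_univ, hV]
        decide
      · have : (Finset.univ.filter fun v : V =>
            (if v = w then (2 : Fin 3) else if v = a then 1 else 0) = 1) = {a} := by
          ext v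
          by_cases h1 : v = w <;> by_cases h2 : v = a <;> simp_all
        simp only [Fin.mk_one, this, Finset.card_singleton]
        decide
      · have : (Finset.univ.filter fun v : V =>
            (if v = w then (2 : Fin 3) else if v = a then 1 else 0) = 2) = {w} := by
          ext v
          by_cases h1 : v = w <;> by_cases h2 : v = a <;> simp_all
        simp only [Fin.reduceFinMk, this, Finset.card_singleton]
        decide
  · left
    push Not at h
    refine nonempty_iso_of_coloring (fun v => decide (v = w)) Sum.isRight
      (fun x y => x = false ∧ y = false) ?_ ?_ ?_
    · intro u v
      by_cases hu : u = w
      · simp [hu, h]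
      by_cases hv : v = w
      · simp [hv, fun u => mt G.adj_symm (h u)]
      · simp only [hu, hv, decide_false, and_true]
        exact ⟨fun h => h.ne, hadj u v hu hv⟩
    · rintro (u | u) (v | v) <;> simp
      exact Subsingleton.elim u v
    · rintro (_ | _)
      · rw [Fintype.card_subtype]
        have : (Finset.univ.filter fun v : V => decide (v = w) = false) = Finset.univ.erase w := by
          ext v; simp
        rw [this, Finset.card_erase_of_mem (Finset.mem_univ w), Finset.card_univ, hV]
        decide
      · rw [Fintype.card_subtype]
        have : (Finset.univ.filter fun v : V => decide (v = w) = true) = {w} := by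
          ext v; simp
        rw [this, Finset.card_singleton]
        decide

end Six

/-! ### The four ranges of `n`. -/

theorem cliqueSpectralRadius_le_K {V : Type*} [Fintype V] {G : SimpleGraph V} {n : ℕ}
    (hV : Fintype.card V = n) (h3 : 3 ≤ n) :
    cliqueSpectralRadius 3 G ≤ cliqueSpectralRadius 3 (K n) ∧
      (cliqueSpectralRadius 3 G = cliqueSpectralRadius 3 (K n) ↔ Nonempty (G ≃g K n)) := by
  have h1 := cliqueSpectralRadius_le_of_card (G := G) (by omega)
  have h2 := le_cliqueSpectralRadius_K n (by omega)
  rw [hV] at h1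
  refine ⟨by linarith [h1.1], fun heq => ?_, fun ⟨e⟩ => cliqueSpectralRadius_three_congr e⟩
  have hG := h1.2 (le_antisymm h1.1 (by rw [heq]; exact h2))
  subst hG
  exact ⟨SimpleGraph.Iso.completeGraph (Fintype.equivFinOfCardEq hV)⟩

theorem cliqueSpectralRadius_le_six {V : Type*} [Fintype V] {G : SimpleGraph V}
    (hV : Fintype.card V = 6) (hG : TrianglesIntersect G) :
    cliqueSpectralRadius 3 G ≤ cliqueSpectralRadius 3 (K 5 ⊕g K 1) ∧
      (cliqueSpectralRadius 3 G = cliqueSpectralRadius 3 (K 5 ⊕g K 1) ↔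
        Nonempty (G ≃g (K 5 ⊕g K 1)) ∨ Nonempty (G ≃g G₀)) := by
  have hK := cliqueSpectralRadius_eq_six trianglesIntersect_K5_sum isNClique_five_K5_sum
  have hG₀ := cliqueSpectralRadius_eq_six trianglesIntersect_G₀ isNClique_five_G₀
  have hback : Nonempty (G ≃g (K 5 ⊕g K 1)) ∨ Nonempty (G ≃g G₀) →
      cliqueSpectralRadius 3 G = cliqueSpectralRadius 3 (K 5 ⊕g K 1) := by
    rintro (⟨⟨e⟩⟩ | ⟨⟨e⟩⟩)
    · exact cliqueSpectralRadius_three_congr e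
    · rw [cliqueSpectralRadius_three_congr e, hG₀, hK]
  have : Nonempty V := Fintype.card_pos_iff.1 (by omega)
  have hstrict : cliqueSpectralRadius 3 G < 6 →
      cliqueSpectralRadius 3 G ≤ cliqueSpectralRadius 3 (K 5 ⊕g K 1) ∧
      (cliqueSpectralRadius 3 G = cliqueSpectralRadius 3 (K 5 ⊕g K 1) ↔
        Nonempty (G ≃g (K 5 ⊕g K 1)) ∨ Nonempty (G ≃g G₀)) := fun h =>
    ⟨by rw [hK]; exact h.le, fun h' => absurd (h'.trans hK) h.ne, hback⟩
  rcases hG.cover_trichotomy with ⟨v, hv⟩ | ⟨a, b, hab, hcov, ha, hb⟩ | ⟨s, hs⟩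
  · obtain ⟨κ, hκ, hκ3⟩ := exists_cube_root (a := (((5 + 1) / 2 * (5 / 2) : ℕ) : ℝ)) (by norm_num)
    refine hstrict ((cliqueSpectralRadius_le_of_vertex_cover hV (by norm_num) hv hκ hκ3).1.trans_lt ?_)
    -- Here `κ ^ 3 = 3 * 2 = 6`, so `(κ ^ 2) ^ 3 = 36`, well below `6 ^ 3`.
    norm_num at hκ3
    by_contra! h
    have h1 : (6 : ℝ) ^ 3 ≤ (κ ^ 2) ^ 3 := pow_le_pow_left₀ (by norm_num) h 3
    have h2 : (κ ^ 2) ^ 3 = 6 ^ 2 := by rw [← hκ3]; ring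
    norm_num [h2] at h1
  · obtain ⟨r, hr, hrs⟩ := exists_core_root 3 (by norm_num)
    exact hstrict ((cliqueSpectralRadius_le_of_pair_cover hV le_rfl hG hab hcov ha hb hr hrs).1.trans_lt
      (core_three_lt_six hrs))
  · have h6 := cliqueSpectralRadius_eq_six hG hs
    exact ⟨by rw [h6, hK], fun _ => nonempty_iso_of_isNClique_five hV hG hs, hback⟩

theorem cliqueSpectralRadius_le_core {V : Type*} [Fintype V] {G : SimpleGraph V} {n : ℕ}
    (hV : Fintype.card V = n) (h7 : 7 ≤ n) (h13 : n ≤ 13) (hG : TrianglesIntersect G) :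
    cliqueSpectralRadius 3 G ≤ cliqueSpectralRadius 3 (join (K 3) (isolated (n - 3))) ∧
      (cliqueSpectralRadius 3 G = cliqueSpectralRadius 3 (join (K 3) (isolated (n - 3))) ↔
        Nonempty (G ≃g join (K 3) (isolated (n - 3)))) := by
  have : Nonempty V := Fintype.card_pos_iff.1 (by omega)
  obtain ⟨r, hr, hrs⟩ := exists_core_root (n - 3) (by omega)
  have hlow := le_cliqueSpectralRadius_core (n - 3) hrs
  have hback : Nonempty (G ≃g join (K 3) (isolated (n - 3))) → cliqueSpectralRadius 3 G =
      cliqueSpectralRadius 3 (join (K 3) (isolated (n - 3))) :=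
    fun ⟨e⟩ => cliqueSpectralRadius_three_congr e
  rcases hG.cover_trichotomy with ⟨v, hv⟩ | ⟨a, b, hab, hcov, ha, hb⟩ | ⟨s, hs⟩
  · obtain ⟨κ, hκ, hκ3⟩ := exists_cube_root
      (a := (((n - 1 + 1) / 2 * ((n - 1) / 2) : ℕ) : ℝ)) (by
        have : 0 < (n - 1 + 1) / 2 * ((n - 1) / 2) := Nat.mul_pos (by omega) (by omega)
        exact_mod_cast this)
    have h1 := (cliqueSpectralRadius_le_of_vertex_cover (N := n - 1) (by omega) (by omega)
      hv hκ hκ3).1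
    have h2 := vertex_bound_lt_core h7 h13 hr hrs hκ hκ3
    exact ⟨by linarith, fun h => by linarith, hback⟩
  · have h1 := cliqueSpectralRadius_le_of_pair_cover (m := n - 3) (by omega) (by omega)
      hG hab hcov ha hb hr hrs
    exact ⟨h1.1.trans hlow, fun h => h1.2 (le_antisymm h1.1 (h ▸ hlow)), hback⟩
  · have h1 := cliqueSpectralRadius_eq_six hG hs
    have h2 := six_lt_core (m := n - 3) (by omega) hr hrs
    exact ⟨by linarith, fun h => by linarith, hback⟩

theorem cliqueSpectralRadius_le_join_turanGraph {V : Type*} [Fintype V] {G : SimpleGraph V} {n : ℕ}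
    (hV : Fintype.card V = n) (h14 : 14 ≤ n) (hG : TrianglesIntersect G) :
    cliqueSpectralRadius 3 G ≤
        cliqueSpectralRadius 3 (join (K 1) (SimpleGraph.turanGraph (n - 1) 2)) ∧
      (cliqueSpectralRadius 3 G =
          cliqueSpectralRadius 3 (join (K 1) (SimpleGraph.turanGraph (n - 1) 2)) ↔
        Nonempty (G ≃g join (K 1) (SimpleGraph.turanGraph (n - 1) 2))) := by
  have : Nonempty V := Fintype.card_pos_iff.1 (by omega)
  obtain ⟨r, hr, hrs⟩ := exists_core_root (n - 3) (by omega)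
  obtain ⟨κ, hκ, hκ3⟩ := exists_cube_root
    (a := (((n - 1 + 1) / 2 * ((n - 1) / 2) : ℕ) : ℝ)) (by
      have : 0 < (n - 1 + 1) / 2 * ((n - 1) / 2) := Nat.mul_pos (by omega) (by omega)
      exact_mod_cast this)
  have hlow := le_cliqueSpectralRadius_join_turanGraph (n - 1) (by omega) hκ hκ3
  have hlt := core_lt_vertex_bound h14 hr hrs hκ hκ3
  have hback : Nonempty (G ≃g join (K 1) (SimpleGraph.turanGraph (n - 1) 2)) →
      cliqueSpectralRadius 3 G =
        cliqueSpectralRadius 3 (join (K 1) (SimpleGraph.turanGraph (n - 1) 2)) :=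
    fun ⟨e⟩ => cliqueSpectralRadius_three_congr e
  rcases hG.cover_trichotomy with ⟨v, hv⟩ | ⟨a, b, hab, hcov, ha, hb⟩ | ⟨s, hs⟩
  · have h1 := cliqueSpectralRadius_le_of_vertex_cover (N := n - 1) (by omega) (by omega)
      hv hκ hκ3
    exact ⟨h1.1.trans hlow, fun h => h1.2 (le_antisymm h1.1 (h ▸ hlow)), hback⟩
  · have h1 := (cliqueSpectralRadius_le_of_pair_cover (m := n - 3) (by omega) (by omega)
      hG hab hcov ha hb hr hrs).1
    exact ⟨by linarith, fun h => by linarith, hback⟩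
  · have h1 := cliqueSpectralRadius_eq_six hG hs
    have h2 := six_lt_core (m := n - 3) (by omega) hr hrs
    exact ⟨by linarith, fun h => by linarith, hback⟩

end CliqueSpectral

open CliqueSpectral in
theorem theorem1p8 (n : ℕ) :
    -- (i) 3 ≤ n ≤ 5
    (3 ≤ n → n ≤ 5 →
      twoK3.Free (K n) ∧
      ∀ (V : Type u) [Fintype V] (G : SimpleGraph V), Fintype.card V = n → twoK3.Free G →
        cliqueSpectralRadius 3 G ≤ cliqueSpectralRadius 3 (K n) ∧
        (cliqueSpectralRadius 3 G = cliqueSpectralRadius 3 (K n) ↔ Nonempty (G ≃g K n))) ∧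
    -- (ii) n = 6
    (n = 6 →
      twoK3.Free (K 5 ⊕g K 1) ∧ twoK3.Free G₀ ∧
      ∀ (V : Type u) [Fintype V] (G : SimpleGraph V), Fintype.card V = n → twoK3.Free G →
        cliqueSpectralRadius 3 G ≤ cliqueSpectralRadius 3 (K 5 ⊕g K 1) ∧
        (cliqueSpectralRadius 3 G = cliqueSpectralRadius 3 (K 5 ⊕g K 1) ↔
          Nonempty (G ≃g (K 5 ⊕g K 1)) ∨ Nonempty (G ≃g G₀))) ∧
    -- (iii) 7 ≤ n ≤ 13
    (7 ≤ n → n ≤ 13 →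
      twoK3.Free (join (K 3) (isolated (n - 3))) ∧
      ∀ (V : Type u) [Fintype V] (G : SimpleGraph V), Fintype.card V = n → twoK3.Free G →
        cliqueSpectralRadius 3 G ≤ cliqueSpectralRadius 3 (join (K 3) (isolated (n - 3))) ∧
        (cliqueSpectralRadius 3 G = cliqueSpectralRadius 3 (join (K 3) (isolated (n - 3))) ↔
          Nonempty (G ≃g join (K 3) (isolated (n - 3))))) ∧
    -- (iv) 14 ≤ n
    (14 ≤ n →
      twoK3.Free (join (K 1) (SimpleGraph.turanGraph (n - 1) 2)) ∧
      ∀ (V : Type u) [Fintype V] (G : SimpleGraph V), Fintype.card V = n → twoK3.Free G →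
        cliqueSpectralRadius 3 G ≤
          cliqueSpectralRadius 3 (join (K 1) (SimpleGraph.turanGraph (n - 1) 2)) ∧
        (cliqueSpectralRadius 3 G =
            cliqueSpectralRadius 3 (join (K 1) (SimpleGraph.turanGraph (n - 1) 2)) ↔
          Nonempty (G ≃g join (K 1) (SimpleGraph.turanGraph (n - 1) 2)))) := by
  refine ⟨fun h3 h5 => ⟨free_of_trianglesIntersect (trianglesIntersect_K h5),
      fun V _ G hV _ => cliqueSpectralRadius_le_K hV h3⟩,
    fun h6 => ⟨free_of_trianglesIntersect trianglesIntersect_K5_sum,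
      free_of_trianglesIntersect trianglesIntersect_G₀,
      fun V _ G hV hG => cliqueSpectralRadius_le_six (hV.trans h6) (trianglesIntersect_of_free hG)⟩,
    fun h7 h13 => ⟨free_of_trianglesIntersect (trianglesIntersect_core _),
      fun V _ G hV hG => cliqueSpectralRadius_le_core hV h7 h13 (trianglesIntersect_of_free hG)⟩,
    fun h14 => ⟨free_of_trianglesIntersect (trianglesIntersect_join_turanGraph _),
      fun V _ G hV hG => cliqueSpectralRadius_le_join_turanGraph hV h14
        (trianglesIntersect_of_free hG)⟩⟩
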